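/- Let $d\ge 1$, $L_\alpha>0$, $\alpha\in[0,1]$, and let $f:\mathbb R^d\to\mathbb R$ be $L_\alpha$-$\alpha$-semi-smooth: $f$ is locally Lipschitz and has a selection $f'$ of subgradients (in the sense of Clarke, with $f'(x)=\nabla f(x)$ wherever $f$ is differentiable) such that $\|f'(u)-f'(v)\|\le L_\alpha\|u-v\|^\alpha$ for all $u,v\in\mathbb R^d$. Let $\eta>0$ and $y\in\mathbb R^d$, let $\pi^{X|Y}(\cdot|y)$ be the probability distribution on $\mathbb R^d$ with density proportional to $\exp\left(-f(x)-\frac1{2\eta}\|x-y\|^2\right)$, let $x_y$ be a point with $f'(x_y)+\frac1\eta(x_y-y)=0$, and put $g(x)=f(x)-\langle f'(x_y),x\rangle$. Consider the following algorithm: repeatedly draw, independently, $x$ and $z$ from the Gaussian distribution with density proportional to $\exp\left(-\frac1{2\eta}\|\cdot-x_y\|^2\right)$ and $u$ uniformly from $[0,1]$, and set $\rho=\exp(g(z)-g(x))$, until $u\le\frac12\rho$; then return the last $x$. Each pass through the loop evaluates $f$ at the two points $x$ and $z$. There is an absolute constant $C$ such that the following holds for all such $d,L_\alpha,\alpha,f,f',\eta,y,x_y$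 and every $\zeta>0$. If $$\eta\le\min\left(\left(49\,L_\alpha^{\frac{2}{\alpha+1}}d^{\frac{\alpha}{\alpha+1}}\left(2+\log\left(1+\frac{192(d^2+2d)}{\zeta^4}\right)\right)\right)^{-1},\,1\right),$$ then the algorithm terminates almost surely, and the distribution of the returned point is within Wasserstein-2 distance $\zeta$ of $\pi^{X|Y}(\cdot|y)$. If moreover $\zeta<2\sqrt{2d}$, then the expected number of evaluations of $f$ made by the algorithm is at most $C$. -/

import Mathlib

open MeasureTheory Filter Topology
open scoped ENNReal

noncomputable section

/-- Euclidean space `ℝ^d`. -/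
abbrev Euc (d : ℕ) : Type := EuclideanSpace ℝ (Fin d)

/-- The Clarke subdifferential of `f` at `x`: the vectors `ξ` with `⟨ξ, v⟩ ≤ f°(x; v)` for all
directions `v`, where `f°(x; v) = limsup_{p → x, t ↓ 0} (f (p + t v) - f p) / t`. -/
def clarkeSubdifferential {d : ℕ} (f : Euc d → ℝ) (x : Euc d) : Set (Euc d) :=
  {ξ | ∀ v : Euc d, ((inner ℝ ξ v : ℝ) : EReal) ≤
    limsup (fun q : Euc d × ℝ => (((f (q.1 + q.2 • v) - f q.1) / q.2 : ℝ) : EReal))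
      (𝓝 x ×ˢ 𝓝[>] (0 : ℝ))}

/-- `f'` selects a subgradient of the locally Lipschitz function `f` at every point; where `f` is
differentiable the subgradient is the gradient. -/
structure IsSubgradientSelection {d : ℕ} (f : Euc d → ℝ) (f' : Euc d → Euc d) : Prop where
  locallyLipschitz : LocallyLipschitz f
  mem_subdifferential : ∀ x, f' x ∈ clarkeSubdifferential f x
  eq_gradient : ∀ x, DifferentiableAt ℝ f x → f' x = gradient f x

/-- `f`, with subgradients `f'`, is `L`-`α`-semi-smooth. -/
structure IsSemiSmooth {d : ℕ} (f : Euc d → ℝ) (f' : Euc d → Euc d) (L α : ℝ) : Prop where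
  subgradient : IsSubgradientSelection f f'
  holder : ∀ u v, ‖f' u - f' v‖ ≤ L * ‖u - v‖ ^ α

/-- The target of the restricted Gaussian oracle: the probability distribution
`∝ exp (-f x - ‖x - y‖² / (2 η))`. -/
def rgoTarget {d : ℕ} (f : Euc d → ℝ) (η : ℝ) (y : Euc d) : Measure (Euc d) :=
  (volume : Measure (Euc d)).tilted (fun x => -f x - 1 / (2 * η) * ‖x - y‖ ^ 2)

/-- The Gaussian proposal distribution `∝ exp (-‖x - m‖² / (2 η))`. -/
def proposal {d : ℕ} (η : ℝ) (m : Euc d) : Measure (Euc d) :=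
  (volume : Measure (Euc d)).tilted (fun x => -(1 / (2 * η) * ‖x - m‖ ^ 2))

/-- The random draws `(x, z, u)` of one pass through the loop. -/
abbrev Draw (d : ℕ) : Type := Euc d × Euc d × ℝ

/-- The law of the draws of all passes: independent, with `x, z` from the proposal distribution
and `u` uniform on `[0, 1]`, all independent. -/
def drawsLaw {d : ℕ} (η : ℝ) (m : Euc d) : Measure (ℕ → Draw d) :=
  Measure.infinitePi fun _ : ℕ =>
    (proposal η m).prod ((proposal η m).prod ((volume : Measure ℝ).restrict (Set.Icc 0 1)))

/-- State of the rejection sampling loop: the returned point, if the loop has stopped, and the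
number of evaluations of `f` made so far. -/
structure LoopState (d : ℕ) where
  result : Option (Euc d)
  queries : ℕ

/-- `g x = f x - ⟨f' x_y, x⟩`. -/
def shifted {d : ℕ} (f : Euc d → ℝ) (f' : Euc d → Euc d) (xy x : Euc d) : ℝ :=
  f x - inner ℝ (f' xy) x

open Classical in
/-- One pass through the loop on the draws `(x, z, u)`. It evaluates `f` at `z` and at `x`, sets
`ρ = exp (g z - g x)`, and returns `x` if `u ≤ ρ / 2`. A stopped loop does nothing. -/
def loopStep {d : ℕ} (f : Euc d → ℝ) (f' : Euc d → Euc d) (xy : Euc d)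
    (s : LoopState d) (w : Draw d) : LoopState d :=
  match s.result with
  | some _ => s
  | none =>
    { result :=
        if w.2.2 ≤ 1 / 2 * Real.exp (shifted f f' xy w.2.1 - shifted f f' xy w.1)
        then some w.1 else none
      queries := s.queries + 2 }

/-- The state after (at most) `n` passes, on the sequence `ω` of draws. -/
def loopState {d : ℕ} (f : Euc d → ℝ) (f' : Euc d → Euc d) (xy : Euc d)
    (ω : ℕ → Draw d) : ℕ → LoopState d
  | 0 => { result := none, queries := 0 }
  | n + 1 => loopStep f f' xy (loopState f f' xy ω n) (ω n)

/-- The loop stops on the sequence `ω` of draws. -/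
def Stops {d : ℕ} (f : Euc d → ℝ) (f' : Euc d → Euc d) (xy : Euc d) (ω : ℕ → Draw d) : Prop :=
  ∃ n, (loopState f f' xy ω n).result.isSome

/-- The point returned on the sequence `ω` of draws (the value `0` if the loop never stops). -/
def returned {d : ℕ} (f : Euc d → ℝ) (f' : Euc d → Euc d) (xy : Euc d) (ω : ℕ → Draw d) :
    Euc d :=
  (loopState f f' xy ω (sInf {n | (loopState f f' xy ω n).result.isSome})).result.getD 0

/-- The total number of evaluations of `f` on the sequence `ω` of draws, possibly infinite. -/
def totalQueries {d : ℕ} (f : Euc d → ℝ) (f' : Euc d → Euc d) (xy : Euc d) (ω : ℕ → Draw d) :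
    ℝ≥0∞ :=
  ⨆ n, ((loopState f f' xy ω n).queries : ℝ≥0∞)

/-- The distribution of the point returned by the algorithm. -/
def outputLaw {d : ℕ} (f : Euc d → ℝ) (f' : Euc d → Euc d) (η : ℝ) (xy : Euc d) :
    Measure (Euc d) :=
  (drawsLaw η xy).map (returned f f' xy)

/-- The Wasserstein-2 distance. -/
def wasserstein2 {d : ℕ} (μ ν : Measure (Euc d)) : ℝ≥0∞ :=
  (⨅ (γ : ProbabilityMeasure (Euc d × Euc d))
      (_ : (γ : Measure (Euc d × Euc d)).map Prod.fst = μ ∧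
        (γ : Measure (Euc d × Euc d)).map Prod.snd = ν),
    ∫⁻ p, ENNReal.ofReal (‖p.1 - p.2‖ ^ 2) ∂(γ : Measure (Euc d × Euc d))) ^ (1 / 2 : ℝ)

end

open ProbabilityTheory

/-! Write γ for the Gaussian proposal centred at `xy` and ρ = exp (g z - g x). Given x and z, a pass
accepts with probability min(ρ, 2)/2. Hence the output has γ-density R/A, where R(x) is the z-mean
of min(ρ, 2) and A = ∫ R dγ, and a pass accepts with probability A/2. Exchanging x and z turns ρ
into 1/ρ, and min(ρ, 2) + min(1/ρ, 2) ≥ 2, so A ≥ 1. The number of passes is thus geometric with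
mean at most 2, whatever the step size.

Stationarity of `xy` makes the target proportional to exp(-g) dγ. The z-mean of the untruncated ρ is
a constant times exp(-g x), so the target has density (R + E)/(A + Δ), where E(x) is the z-mean of
the excess (ρ - 2)₊ and Δ = ∫ E dγ. The two densities differ by at most 2Δ + E (`tsub_add_tsub_le`).
Keeping their common mass fixed bounds W₂² by the integral of this difference against 2‖x - xy‖²
(`wasserstein2_withDensity_le`).

It remains to show that large values of g z - g x are rare. Pisier's inequality bounds the
exponential moment of the increment of a function of a Gaussian by one of its squared gradient
(`lintegral_exp_sub_stdGaussian_le`). Semi-smoothness gives ‖∇g(x)‖ ≤ L‖x - xy‖^α almost everywhere,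
and the step size is chosen so that the moment of order 2T is at most √2 exp(T/4), with T = 2 +
log(1 + q) the factor in the step size. A Markov-type bound at the threshold log 2 then makes the
weighted excess of order d² exp(-T)/ζ², up to a small multiple of ζ². -/

/-! ### Gaussian measures and their moments. -/

theorem integrable_exp_neg_sq_norm_sub {d : ℕ} {b : ℝ} (hb : 0 < b) (m : Euc d) :
    Integrable (fun x : Euc d => Real.exp (-(b * ‖x - m‖ ^ 2))) := by
  have h : Integrable (fun x : Euc d => Real.exp (-b * ‖x‖ ^ 2)) := by
    apply Integrable.of_integral_ne_zero
    rw [GaussianFourier.integral_rexp_neg_mul_sq_norm hb]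
    positivity
  simpa using h.comp_sub_right m

theorem integral_exp_neg_sq_norm_sub {d : ℕ} {b : ℝ} (hb : 0 < b) (m : Euc d) :
    ∫ x : Euc d, Real.exp (-(b * ‖x - m‖ ^ 2)) = (Real.pi / b) ^ ((d : ℝ) / 2) := by
  rw [integral_sub_right_eq_self (fun x : Euc d => Real.exp (-(b * ‖x‖ ^ 2))) m]
  simpa using GaussianFourier.integral_rexp_neg_mul_sq_norm (V := Euc d) hb

theorem isProbabilityMeasure_proposal {d : ℕ} {η : ℝ} (hη : 0 < η) (m : Euc d) :
    IsProbabilityMeasure (proposal η m) :=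
  isProbabilityMeasure_tilted (integrable_exp_neg_sq_norm_sub (by positivity) m)

theorem charFun_proposal {d : ℕ} {η : ℝ} (hη : 0 < η) (m t : Euc d) :
    charFun (proposal η m) t =
      Complex.exp (inner ℝ m t * Complex.I) * Complex.exp (-(η * ‖t‖ ^ 2 / 2)) := by
  have hb : 0 < 1 / (2 * η) := by positivity
  have hb' : 0 < ((1 / (2 * η) : ℝ) : ℂ).re := by simpa using hη
  rw [charFun_apply, proposal, integral_tilted, integral_exp_neg_sq_norm_sub hb]
  set Z : ℝ := (Real.pi / (1 / (2 * η))) ^ ((d : ℝ) / 2) with hZ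
  have hZ0 : 0 < Z := by positivity
  have key : ∀ x : Euc d, (Real.exp (-(1 / (2 * η) * ‖x - m‖ ^ 2)) / Z) •
      Complex.exp (inner ℝ x t * Complex.I) =
      (fun v : Euc d => (Complex.exp (inner ℝ m t * Complex.I) / Z) *
        Complex.exp (-((1 / (2 * η) : ℝ) : ℂ) * ‖v‖ ^ 2 + Complex.I * inner ℝ t v)) (x - m) := by
    intro x
    have : (inner ℝ x t : ℝ) = inner ℝ m t + inner ℝ t (x - m) := by
      rw [inner_sub_right, real_inner_comm t m, real_inner_comm x t]; ring
    simp only [this, Complex.real_smul]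
    push_cast
    rw [div_mul_eq_mul_div, ← Complex.exp_add,
      div_mul_eq_mul_div (Complex.exp _) (Z : ℂ), ← Complex.exp_add]
    congr 2
    ring
  simp_rw [key]
  rw [integral_sub_right_eq_self (μ := (volume : Measure (Euc d))) (fun v : Euc d => (Complex.exp (inner ℝ m t * Complex.I) / Z) *
        Complex.exp (-((1 / (2 * η) : ℝ) : ℂ) * ‖v‖ ^ 2 + Complex.I * inner ℝ t v)) m,
    integral_const_mul, GaussianFourier.integral_cexp_neg_mul_sq_norm_add hb']
  have hZc : ((Real.pi : ℂ) / ((1 / (2 * η) : ℝ) : ℂ)) ^ (Module.finrank ℝ (Euc d) / 2 : ℂ) = Z := by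
    rw [hZ, ← Complex.ofReal_div, Complex.ofReal_cpow (by positivity)]
    simp
  rw [hZc]
  have hZ1 : (Z : ℂ) ≠ 0 := by exact_mod_cast hZ0.ne'
  have hη1 : (η : ℂ) ≠ 0 := by exact_mod_cast hη.ne'
  have : Complex.I ^ 2 * ‖t‖ ^ 2 / (4 * ((1 / (2 * η) : ℝ) : ℂ)) = -(η * ‖t‖ ^ 2 / 2) := by
    rw [Complex.I_sq]; push_cast; field_simp; ring
  rw [this]
  field_simp

/-- Characteristic functions agree. This moves every integral to the standard Gaussian, where
rotation invariance is available. -/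
theorem proposal_eq_map_stdGaussian {d : ℕ} {η : ℝ} (hη : 0 < η) (m : Euc d) :
    proposal η m = (stdGaussian (Euc d)).map (fun ξ => m + √η • ξ) := by
  have := isProbabilityMeasure_proposal hη m
  have hm : Measurable (fun ξ : Euc d => m + √η • ξ) := by fun_prop
  have : IsProbabilityMeasure ((stdGaussian (Euc d)).map (fun ξ => m + √η • ξ)) :=
    Measure.isProbabilityMeasure_map hm.aemeasurable
  apply Measure.ext_of_charFun
  ext t
  have h1 : (stdGaussian (Euc d)).map (fun ξ => m + √η • ξ) =
      ((stdGaussian (Euc d)).map (fun ξ => √η • ξ)).map (fun ξ => m + ξ) := by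
    rw [Measure.map_map (by fun_prop) (by fun_prop)]; rfl
  rw [h1, charFun_map_const_add, charFun_map_smul, charFun_stdGaussian, charFun_proposal hη,
    mul_comm, norm_smul, ← Complex.ofReal_pow (‖√η‖ * ‖t‖), mul_pow, Real.norm_eq_abs, sq_abs,
    Real.sq_sqrt hη.le]
  congr 2
  push_cast
  ring

theorem stdGaussian_eq_proposal (d : ℕ) : stdGaussian (Euc d) = proposal 1 0 := by
  rw [proposal_eq_map_stdGaussian one_pos]; simp

theorem stdGaussian_absolutelyContinuous (d : ℕ) :
    stdGaussian (Euc d) ≪ (volume : Measure (Euc d)) := by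
  rw [stdGaussian_eq_proposal]; exact tilted_absolutelyContinuous _ _

theorem measurePreserving_rotation_stdGaussian (d : ℕ) (θ : ℝ) :
    MeasurePreserving (ContinuousLinearMap.rotation θ : Euc d × Euc d →L[ℝ] Euc d × Euc d)
      ((stdGaussian (Euc d)).prod (stdGaussian (Euc d)))
      ((stdGaussian (Euc d)).prod (stdGaussian (Euc d))) :=
  ⟨by fun_prop, IsGaussian.map_rotation_eq_self (by simp) θ⟩

theorem lintegral_exp_inner_stdGaussian {d : ℕ} (a : Euc d) :
    ∫⁻ y, ENNReal.ofReal (Real.exp (inner ℝ a y)) ∂(stdGaussian (Euc d)) =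
      ENNReal.ofReal (Real.exp (‖a‖ ^ 2 / 2)) := by
  have hmap : (stdGaussian (Euc d)).map (innerSL ℝ a) = gaussianReal 0 (Real.toNNReal (‖a‖ ^ 2)) := by
    rw [IsGaussian.map_eq_gaussianReal, integral_strongDual_stdGaussian,
      variance_dual_stdGaussian, innerSL_apply_norm]
  have h := lintegral_map (μ := stdGaussian (Euc d)) (f := fun r : ℝ => ENNReal.ofReal (Real.exp r))
    (g := innerSL ℝ a) (by fun_prop) (by fun_prop)
  simp only [innerSL_apply_apply] at h
  rw [← h, hmap]
  have hi : Integrable (fun r => Real.exp r) (gaussianReal 0 (Real.toNNReal (‖a‖ ^ 2))) := by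
    simpa using integrable_exp_mul_gaussianReal (μ := 0) (v := Real.toNNReal (‖a‖ ^ 2)) 1
  rw [← ofReal_integral_eq_lintegral_ofReal hi (ae_of_all _ fun _ => (Real.exp_pos _).le)]
  have := congrFun (mgf_fun_id_gaussianReal (μ := 0) (v := Real.toNNReal (‖a‖ ^ 2))) 1
  simp only [mgf, one_mul] at this
  rw [this]
  simp

/-- The integral equals (1 - 1/(2d))^(-d/2), and Bernoulli's inequality gives (1 - 1/(2d))^d ≥ 1/2.
The scale 4d makes the bound independent of the dimension. -/
theorem lintegral_exp_sq_norm_stdGaussian_le {d : ℕ} (hd : 1 ≤ d) :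
    ∫⁻ y, ENNReal.ofReal (Real.exp (‖y‖ ^ 2 / (4 * d))) ∂(stdGaussian (Euc d)) ≤
      ENNReal.ofReal (√2) := by
  have hd' : (1 : ℝ) ≤ d := by exact_mod_cast hd
  set b : ℝ := 1 / 2 - 1 / (4 * d) with hb
  have hbd : b * (2 * (2 * d)) = 2 * d - 1 := by rw [hb]; field_simp; ring
  have hb0 : 0 < b := by
    by_contra h
    nlinarith
  rw [stdGaussian_eq_proposal, proposal, lintegral_tilted]
  have hZ := integral_exp_neg_sq_norm_sub (d := d) (b := 1 / (2 * 1)) (by norm_num) 0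
  rw [hZ]
  set Z : ℝ := (Real.pi / (1 / (2 * 1))) ^ ((d : ℝ) / 2) with hZd
  have hZ0 : 0 < Z := by positivity
  have key : ∀ x : Euc d, ENNReal.ofReal (Real.exp (-(1 / (2 * 1) * ‖x - 0‖ ^ 2)) / Z) *
      ENNReal.ofReal (Real.exp (‖x‖ ^ 2 / (4 * d))) =
      ENNReal.ofReal (Real.exp (-(b * ‖x - 0‖ ^ 2)) / Z) := by
    intro x
    rw [← ENNReal.ofReal_mul (by positivity), div_mul_eq_mul_div, ← Real.exp_add, hb]
    congr 3
    simp only [sub_zero]; ring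
  simp_rw [key]
  rw [← ofReal_integral_eq_lintegral_ofReal
    ((integrable_exp_neg_sq_norm_sub hb0 0).div_const Z) (ae_of_all _ fun _ => by positivity),
    integral_div, integral_exp_neg_sq_norm_sub hb0, hZd, ← Real.div_rpow (by positivity) (by positivity)]
  apply ENNReal.ofReal_le_ofReal
  have e1 : Real.pi / b / (Real.pi / (1 / (2 * 1))) = (2 * b)⁻¹ := by
    have := Real.pi_pos; field_simp
  rw [e1, Real.inv_rpow (by positivity)]
  have hB : (1 / 2 : ℝ) ≤ (2 * b) ^ d := by
    have h2 : 2 * b = 1 + (-(1 / (2 * d)) : ℝ) := by rw [hb]; field_simp; ring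
    have := one_add_mul_le_pow (a := (-(1 / (2 * d)) : ℝ)) (by
      rw [neg_le_neg_iff, div_le_iff₀ (by positivity)]; linarith) d
    rw [h2]
    refine le_trans (le_of_eq ?_) this
    field_simp; norm_num
  have h3 : (2 * b) ^ ((d : ℝ) / 2) = √((2 * b) ^ d) := by
    rw [Real.sqrt_eq_rpow, ← Real.rpow_natCast, ← Real.rpow_mul (by positivity)]
    congr 1; ring
  rw [h3, ← Real.sqrt_inv]
  apply Real.sqrt_le_sqrt
  rw [inv_le_comm₀ (by positivity) (by norm_num)]
  simpa using hB

/-! ### Locally Lipschitz functions and Pisier's inequality. -/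

theorem LocallyLipschitz.exists_lipschitzOnWith_of_isCompact {X Y : Type*} [PseudoMetricSpace X]
    [PseudoMetricSpace Y] {F : X → Y} (hF : LocallyLipschitz F) {s : Set X} (hs : IsCompact s) :
    ∃ K, LipschitzOnWith K F s :=
  hF.locallyLipschitzOn.exists_lipschitzOnWith_of_compact hs

theorem LocallyLipschitz.ae_differentiableAt {d : ℕ} {F : Euc d → ℝ} (hF : LocallyLipschitz F) :
    ∀ᵐ x, DifferentiableAt ℝ F x := by
  have h : ∀ n : ℕ, ∀ᵐ x, x ∈ Metric.ball (0 : Euc d) n → DifferentiableAt ℝ F x := by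
    intro n
    obtain ⟨K, hK⟩ := hF.exists_lipschitzOnWith_of_isCompact (isCompact_closedBall (0 : Euc d) n)
    filter_upwards [(hK.mono Metric.ball_subset_closedBall).ae_differentiableWithinAt_of_mem
      (μ := volume)] with x hx hxn
    exact (hx hxn).differentiableAt (Metric.isOpen_ball.mem_nhds hxn)
  filter_upwards [ae_all_iff.2 h] with x hx
  obtain ⟨n, hn⟩ := exists_nat_gt ‖x‖
  exact hx n (by simpa using hn)

theorem ofReal_exp_integral_le_lintegral {Ω : Type*} [MeasurableSpace Ω] (P : Measure Ω)
    [IsProbabilityMeasure P] {h : Ω → ℝ} (hh : Integrable h P) :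
    ENNReal.ofReal (Real.exp (∫ ω, h ω ∂P)) ≤ ∫⁻ ω, ENNReal.ofReal (Real.exp (h ω)) ∂P := by
  have hm : AEStronglyMeasurable (fun ω => Real.exp (h ω)) P :=
    Real.continuous_exp.comp_aestronglyMeasurable hh.1
  by_cases hi : Integrable (fun ω => Real.exp (h ω)) P
  · rw [← ofReal_integral_eq_lintegral_ofReal hi (ae_of_all _ fun _ => (Real.exp_pos _).le)]
    apply ENNReal.ofReal_le_ofReal
    exact convexOn_exp.map_integral_le Real.continuous_exp.continuousOn isClosed_univ
      (by simp) hh hi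
  -- If exp h is not integrable, the right side is infinite and there is nothing to prove.
  · have : ∫⁻ ω, ENNReal.ofReal (Real.exp (h ω)) ∂P = ⊤ := by
      by_contra h'
      exact hi ((lintegral_ofReal_ne_top_iff_integrable hm
        (ae_of_all _ fun _ => (Real.exp_pos _).le)).1 h')
    simp [this]

/-- The uniform probability distribution on the interval of angles `(0, π/2]`. -/
noncomputable def uniformAngle : Measure ℝ :=
  ENNReal.ofReal (2 / Real.pi) • (volume : Measure ℝ).restrict (Set.Ioc 0 (Real.pi / 2))

instance isProbabilityMeasure_uniformAngle : IsProbabilityMeasure uniformAngle := ⟨by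
  have := Real.pi_pos
  rw [uniformAngle, Measure.smul_apply, Measure.restrict_apply_univ, Real.volume_Ioc, smul_eq_mul,
    ← ENNReal.ofReal_mul (by positivity)]
  have : 2 / Real.pi * (Real.pi / 2 - 0) = 1 := by field_simp; simp
  rw [this]; simp⟩

theorem measurable_gradient {d : ℕ} (F : Euc d → ℝ) : Measurable (gradient F) :=
  (InnerProductSpace.toDual ℝ (Euc d)).symm.continuous.measurable.comp (measurable_fderiv ℝ F)

/-- Jensen's inequality for the increment of a locally Lipschitz function, written as the integral
of its derivative along the arc of rotations from `p.1` to `p.2`. -/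
theorem ofReal_exp_sub_le_lintegral_rotation {d : ℕ} {F : Euc d → ℝ} (hF : LocallyLipschitz F)
    (p : Euc d × Euc d)
    (hp : ∀ᵐ θ : ℝ, DifferentiableAt ℝ F (ContinuousLinearMap.rotation θ p).1) :
    ENNReal.ofReal (Real.exp (F p.2 - F p.1)) ≤
      ∫⁻ θ, ENNReal.ofReal (Real.exp (inner ℝ ((Real.pi / 2) •
        gradient F (ContinuousLinearMap.rotation θ p).1)
          (ContinuousLinearMap.rotation θ p).2)) ∂uniformAngle := by
  have hpi := Real.pi_pos
  set c : ℝ → Euc d := fun θ => (ContinuousLinearMap.rotation θ p).1 with hc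
  have hcd : ∀ θ, HasDerivAt c (ContinuousLinearMap.rotation θ p).2 θ := by
    intro θ
    simp only [hc, ContinuousLinearMap.rotation_apply]
    exact ((Real.hasDerivAt_cos θ).smul_const p.1).add ((Real.hasDerivAt_sin θ).smul_const p.2)
  have hcC : ContDiff ℝ 1 c := by
    simp only [hc, ContinuousLinearMap.rotation_apply]
    exact (Real.contDiff_cos.smul contDiff_const).add (Real.contDiff_sin.smul contDiff_const)
  have hk : LocallyLipschitz (F ∘ c) := hF.comp hcC.locallyLipschitz
  obtain ⟨K, hK⟩ := hk.exists_lipschitzOnWith_of_isCompact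
    (isCompact_uIcc (a := (0 : ℝ)) (b := Real.pi / 2))
  have hac := hK.absolutelyContinuousOnInterval
  have hint := hac.intervalIntegrable_deriv
  have hftc := hac.integral_deriv_eq_sub
  rw [intervalIntegrable_iff_integrableOn_Ioc_of_le (by positivity)] at hint
  rw [intervalIntegral.integral_of_le (by positivity)] at hftc
  have e0 : c 0 = p.1 := by simp [hc, ContinuousLinearMap.rotation_apply]
  have e1 : c (Real.pi / 2) = p.2 := by simp [hc, ContinuousLinearMap.rotation_apply]
  have hder : ∀ᵐ θ : ℝ, Real.pi / 2 * deriv (F ∘ c) θ =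
      inner ℝ ((Real.pi / 2) • gradient F (c θ)) (ContinuousLinearMap.rotation θ p).2 := by
    filter_upwards [hp] with θ hθ
    rw [(hθ.hasFDerivAt.comp_hasDerivAt θ (hcd θ)).deriv, real_inner_smul_left,
      inner_gradient_left]
  have hac' : uniformAngle ≪ (volume : Measure ℝ) :=
    (Measure.smul_absolutelyContinuous).trans Measure.restrict_le_self.absolutelyContinuous
  have hi : Integrable (fun θ => Real.pi / 2 * deriv (F ∘ c) θ) uniformAngle :=
    (Integrable.smul_measure hint (by simp)).const_mul _
  have hF2 : F p.2 - F p.1 = ∫ θ, Real.pi / 2 * deriv (F ∘ c) θ ∂uniformAngle := by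
    rw [uniformAngle, integral_smul_measure, integral_const_mul, hftc,
      ENNReal.toReal_ofReal (by positivity), smul_eq_mul]
    simp only [Function.comp, e0, e1]
    field_simp
  rw [hF2]
  refine (ofReal_exp_integral_le_lintegral _ hi).trans (le_of_eq ?_)
  apply lintegral_congr_ae
  filter_upwards [hac'.ae_le hder] with θ hθ
  rw [hθ]

theorem continuous_rotation_uncurry (d : ℕ) : Continuous (fun q : (Euc d × Euc d) × ℝ =>
    (ContinuousLinearMap.rotation q.2 q.1 : Euc d × Euc d)) := by
  simp only [ContinuousLinearMap.rotation_apply]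
  fun_prop

/-- For each fixed angle the rotated point is again Gaussian, so Rademacher's theorem applies to it;
Fubini exchanges the two quantifiers. -/
theorem ae_ae_differentiableAt_rotation {d : ℕ} {F : Euc d → ℝ} (hF : LocallyLipschitz F) :
    ∀ᵐ p ∂((stdGaussian (Euc d)).prod (stdGaussian (Euc d))), ∀ᵐ θ : ℝ,
      DifferentiableAt ℝ F (ContinuousLinearMap.rotation θ p).1 := by
  rw [Measure.ae_ae_comm (p := fun (p : Euc d × Euc d) (θ : ℝ) =>
    DifferentiableAt ℝ F (ContinuousLinearMap.rotation θ p).1)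
    ((measurableSet_of_differentiableAt ℝ F).preimage
      (continuous_rotation_uncurry d).measurable.fst)]
  refine ae_of_all _ fun θ => ?_
  have h1 : ∀ᵐ q ∂((stdGaussian (Euc d)).prod (stdGaussian (Euc d))), DifferentiableAt ℝ F q.1 :=
    Measure.quasiMeasurePreserving_fst.ae
      ((stdGaussian_absolutelyContinuous d).ae_le hF.ae_differentiableAt)
  exact (measurePreserving_rotation_stdGaussian d θ).quasiMeasurePreserving.ae h1

theorem lintegral_lintegral_rotation {d : ℕ} {H : Euc d × Euc d → ℝ≥0∞} (hH : Measurable H) :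
    ∫⁻ p, ∫⁻ θ, H (ContinuousLinearMap.rotation θ p) ∂uniformAngle
        ∂((stdGaussian (Euc d)).prod (stdGaussian (Euc d))) =
      ∫⁻ q, H q ∂((stdGaussian (Euc d)).prod (stdGaussian (Euc d))) := by
  rw [lintegral_lintegral_swap (f := fun (p : Euc d × Euc d) (θ : ℝ) =>
    H (ContinuousLinearMap.rotation θ p))
    (hH.comp (continuous_rotation_uncurry d).measurable).aemeasurable]
  simp_rw [(measurePreserving_rotation_stdGaussian d _).lintegral_comp hH]
  simp

/-- Pisier's inequality for exponentials of increments of a locally Lipschitz function of a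
standard Gaussian vector. -/
theorem lintegral_exp_sub_stdGaussian_le {d : ℕ} {F : Euc d → ℝ} (hF : LocallyLipschitz F) :
    ∫⁻ p, ENNReal.ofReal (Real.exp (F p.2 - F p.1))
        ∂((stdGaussian (Euc d)).prod (stdGaussian (Euc d))) ≤
      ∫⁻ x, ENNReal.ofReal (Real.exp (Real.pi ^ 2 / 8 * ‖gradient F x‖ ^ 2))
        ∂(stdGaussian (Euc d)) := by
  obtain ⟨H, hHdef⟩ : ∃ H : Euc d × Euc d → ℝ≥0∞, H = fun q => ENNReal.ofReal
    (Real.exp (inner ℝ ((Real.pi / 2) • gradient F q.1) q.2)) := ⟨_, rfl⟩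
  have hH : Measurable H := by
    have h : Measurable fun q : Euc d × Euc d => gradient F q.1 :=
      (measurable_gradient F).comp measurable_fst
    rw [hHdef]
    exact (Real.measurable_exp.comp ((h.const_smul (Real.pi / 2)).inner
      measurable_snd)).ennreal_ofReal
  have h1 : ∀ᵐ p ∂((stdGaussian (Euc d)).prod (stdGaussian (Euc d))),
      ENNReal.ofReal (Real.exp (F p.2 - F p.1)) ≤
        ∫⁻ θ, H (ContinuousLinearMap.rotation θ p) ∂uniformAngle := by
    filter_upwards [ae_ae_differentiableAt_rotation hF] with p hp
    rw [hHdef]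
    exact ofReal_exp_sub_le_lintegral_rotation hF p hp
  -- After rotation the position and the velocity along the arc are independent Gaussians, so the
  -- velocity integrates out by the Gaussian Laplace transform.
  have h2 : ∀ x : Euc d, ∫⁻ y, H (x, y) ∂(stdGaussian (Euc d)) =
      ENNReal.ofReal (Real.exp (Real.pi ^ 2 / 8 * ‖gradient F x‖ ^ 2)) := by
    intro x
    have hsq : ‖(Real.pi / 2) • gradient F x‖ ^ 2 / 2 =
        Real.pi ^ 2 / 8 * ‖gradient F x‖ ^ 2 := by
      rw [norm_smul, mul_pow, Real.norm_eq_abs, sq_abs]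
      ring
    rw [← hsq, ← lintegral_exp_inner_stdGaussian, hHdef]
  refine (lintegral_mono_ae h1).trans (le_of_eq ?_)
  rw [lintegral_lintegral_rotation hH, lintegral_prod _ hH.aemeasurable]
  simp_rw [h2]

/-! ### The rejection loop: stopping, query count and output law. -/

/-- The law of the draws of one pass through the loop. -/
noncomputable def drawLaw {d : ℕ} (η : ℝ) (m : Euc d) : Measure (Draw d) :=
  (proposal η m).prod ((proposal η m).prod ((volume : Measure ℝ).restrict (Set.Icc 0 1)))

/-- The draws on which a pass through the loop accepts. -/
def acceptSet {d : ℕ} (f : Euc d → ℝ) (f' : Euc d → Euc d) (xy : Euc d) : Set (Draw d) :=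
  {w | w.2.2 ≤ 1 / 2 * Real.exp (shifted f f' xy w.2.1 - shifted f f' xy w.1)}

section Loop

variable {d : ℕ} {f : Euc d → ℝ} {f' : Euc d → Euc d} {xy : Euc d}

theorem loopState_succ_result (ω : ℕ → Draw d) (n : ℕ) :
    (loopState f f' xy ω (n + 1)).result = none ↔
      (loopState f f' xy ω n).result = none ∧ ω n ∉ acceptSet f f' xy := by
  rw [loopState, loopStep]
  cases h : (loopState f f' xy ω n).result with
  | some x => simp [h]
  | none => simp [acceptSet]

theorem loopState_result_eq_none_iff (ω : ℕ → Draw d) (n : ℕ) :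
    (loopState f f' xy ω n).result = none ↔ ∀ i < n, ω i ∉ acceptSet f f' xy := by
  induction n with
  | zero => simp [loopState]
  | succ n ih =>
    rw [loopState_succ_result, ih]
    constructor
    · rintro ⟨h, h'⟩ i hi
      rcases Nat.lt_succ_iff_lt_or_eq.1 hi with hi | rfl
      · exact h i hi
      · exact h'
    · exact fun h => ⟨fun i hi => h i (hi.trans (Nat.lt_succ_self n)), h n (Nat.lt_succ_self n)⟩

theorem stops_iff (ω : ℕ → Draw d) :
    Stops f f' xy ω ↔ ∃ n, ω n ∈ acceptSet f f' xy := by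
  simp only [Stops, Option.isSome_iff_ne_none, ne_eq, loopState_result_eq_none_iff]
  push Not
  exact ⟨fun ⟨_, i, _, hi⟩ => ⟨i, hi⟩, fun ⟨n, hn⟩ => ⟨n + 1, n, Nat.lt_succ_self n, hn⟩⟩

theorem returned_eq_of_first_accept {ω : ℕ → Draw d} {n : ℕ}
    (hlt : ∀ i < n, ω i ∉ acceptSet f f' xy) (hn : ω n ∈ acceptSet f f' xy) :
    returned f f' xy ω = (ω n).1 := by
  have hnone := (loopState_result_eq_none_iff (f := f) (f' := f') (xy := xy) ω n).2 hlt
  have hsome : (loopState f f' xy ω (n + 1)).result = some (ω n).1 := by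
    rw [loopState, loopStep, hnone]
    exact if_pos hn
  -- States count completed passes, so acceptance on draw n first shows in state n + 1.
  have hinf : sInf {n | (loopState f f' xy ω n).result.isSome} = n + 1 := by
    apply le_antisymm
    · exact Nat.sInf_le (by simp [hsome])
    · apply le_csInf ⟨n + 1, by simp [hsome]⟩
      intro k hk
      by_contra hkn
      have := (loopState_result_eq_none_iff (f := f) (f' := f') (xy := xy) ω k).2
        fun i hi => hlt i (by omega)
      simp [this] at hk
  rw [returned, hinf, hsome, Option.getD_some]

theorem returned_eq_zero_of_not_stops {ω : ℕ → Draw d} (h : ¬ Stops f f' xy ω) :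
    returned f f' xy ω = 0 := by
  have : {n | (loopState f f' xy ω n).result.isSome} = ∅ := by
    ext n; simpa using fun hn => h ⟨n, hn⟩
  rw [returned, this, Nat.sInf_empty]
  rfl

/-- Pass i costs two evaluations exactly when all earlier passes rejected. Integrating these
indicators gives a geometric series. -/
theorem loopState_queries (ω : ℕ → Draw d) (n : ℕ) :
    ((loopState f f' xy ω n).queries : ℝ≥0∞) = ∑ i ∈ Finset.range n,
      (Set.pi (Finset.range i) fun _ => (acceptSet f f' xy)ᶜ).indicator (fun _ => (2 : ℝ≥0∞)) ω := by
  induction n with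
  | zero => simp [loopState]
  | succ n ih =>
    rw [Finset.sum_range_succ, ← ih, loopState, loopStep]
    have hmem : ω ∈ Set.pi (Finset.range n) (fun _ => (acceptSet f f' xy)ᶜ) ↔
        (loopState f f' xy ω n).result = none := by
      rw [loopState_result_eq_none_iff]; simp [Set.mem_pi]
    cases h : (loopState f f' xy ω n).result with
    | some x =>
      rw [Set.indicator_of_notMem (by rw [hmem, h]; simp)]
      simp
    | none =>
      rw [Set.indicator_of_mem (by rw [hmem, h])]
      simp

theorem measurable_shifted (hf : Continuous f) : Measurable (shifted f f' xy) := by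
  have := hf.measurable
  unfold shifted
  fun_prop

theorem measurableSet_acceptSet (hf : Continuous f) : MeasurableSet (acceptSet f f' xy) := by
  have hg := measurable_shifted (f' := f') (xy := xy) hf
  unfold acceptSet
  apply measurableSet_le
  · fun_prop
  · exact ((Real.measurable_exp.comp ((hg.comp measurable_snd.fst).sub
      (hg.comp measurable_fst))).const_mul _)

variable {η : ℝ}

theorem isProbabilityMeasure_drawLaw (hη : 0 < η) (m : Euc d) :
    IsProbabilityMeasure (drawLaw η m) := by
  have := isProbabilityMeasure_proposal hη m
  have : IsProbabilityMeasure ((volume : Measure ℝ).restrict (Set.Icc 0 1)) := ⟨by simp⟩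
  unfold drawLaw
  infer_instance

theorem drawsLaw_pi_range (hη : 0 < η) (m : Euc d) (n : ℕ) {t : ℕ → Set (Draw d)}
    (ht : ∀ i, MeasurableSet (t i)) :
    drawsLaw η m (Set.pi (Finset.range n) t) = ∏ i ∈ Finset.range n, drawLaw η m (t i) := by
  have := isProbabilityMeasure_drawLaw hη m
  exact Measure.infinitePi_pi (fun _ : ℕ => drawLaw η m) fun i _ => ht i

theorem one_sub_measure_compl (hη : 0 < η) (hf : Continuous f) :
    1 - drawLaw η xy (acceptSet f f' xy)ᶜ = drawLaw η xy (acceptSet f f' xy) := by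
  have := isProbabilityMeasure_drawLaw hη xy
  rw [← prob_compl_eq_one_sub (measurableSet_acceptSet hf).compl, compl_compl]

theorem drawsLaw_pi_reject (hη : 0 < η) (hf : Continuous f) (n : ℕ) :
    drawsLaw η xy (Set.pi (Finset.range n) fun _ => (acceptSet f f' xy)ᶜ) =
      drawLaw η xy (acceptSet f f' xy)ᶜ ^ n := by
  rw [drawsLaw_pi_range hη xy n fun _ => (measurableSet_acceptSet hf).compl]
  simp

theorem ae_stops (hη : 0 < η) (hf : Continuous f)
    (hacc : drawLaw η xy (acceptSet f f' xy) ≠ 0) :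
    ∀ᵐ ω ∂(drawsLaw η xy), Stops f f' xy ω := by
  have := isProbabilityMeasure_drawLaw hη xy
  have hr : drawLaw η xy (acceptSet f f' xy)ᶜ < 1 := by
    rw [prob_compl_eq_one_sub (measurableSet_acceptSet hf)]
    exact ENNReal.sub_lt_self ENNReal.one_ne_top one_ne_zero hacc
  rw [ae_iff]
  refine le_antisymm (ge_of_tendsto' (ENNReal.tendsto_pow_atTop_nhds_zero_of_lt_one hr)
    fun n => ?_) zero_le
  rw [← drawsLaw_pi_reject hη hf]
  apply measure_mono
  intro ω hω
  simp only [Set.mem_ofPred_eq, stops_iff, not_exists] at hω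
  exact fun i _ => hω i

theorem lintegral_totalQueries (hη : 0 < η) (hf : Continuous f) :
    ∫⁻ ω, totalQueries f f' xy ω ∂(drawsLaw η xy) =
      2 * (drawLaw η xy (acceptSet f f' xy))⁻¹ := by
  have hm : ∀ i : ℕ, MeasurableSet
      (Set.pi (Finset.range i) fun _ : ℕ => (acceptSet f f' xy)ᶜ : Set (ℕ → Draw d)) := fun i =>
    MeasurableSet.pi (Finset.range i).countable_toSet
      fun _ _ => (measurableSet_acceptSet hf).compl
  simp only [totalQueries, loopState_queries, ← ENNReal.tsum_eq_iSup_nat]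
  rw [lintegral_tsum fun i => (measurable_const.indicator (hm i)).aemeasurable]
  simp_rw [lintegral_indicator_const (hm _), drawsLaw_pi_reject hη hf]
  rw [ENNReal.tsum_mul_left, ENNReal.tsum_geometric, one_sub_measure_compl hη hf]

/-- Splitting by the first accepting pass and summing the geometric series leaves the law of x
conditioned on acceptance. -/
theorem outputLaw_eq (hη : 0 < η) (hf : Continuous f)
    (hacc : drawLaw η xy (acceptSet f f' xy) ≠ 0) :
    outputLaw f f' η xy = (drawLaw η xy (acceptSet f f' xy))⁻¹ •
      ((drawLaw η xy).restrict (acceptSet f f' xy)).map Prod.fst := by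
  have hA := measurableSet_acceptSet (f' := f') (xy := xy) hf
  set A := acceptSet f f' xy with hAdef
  let t (s : Set (Euc d)) (n i : ℕ) : Set (Draw d) := if i < n then Aᶜ else A ∩ Prod.fst ⁻¹' s
  -- The event that the first acceptance occurs on draw n, with its point in s; a cylinder set, so
  -- its mass is a product.
  let B (s : Set (Euc d)) (n : ℕ) : Set (ℕ → Draw d) := Set.pi (Finset.range (n + 1)) (t s n)
  have ht : ∀ s, MeasurableSet s → ∀ n i, MeasurableSet (t s n i) := by
    intro s hs n i
    by_cases h : i < n
    · simpa [t, h] using hA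
    · simpa [t, h] using hA.inter (measurable_fst hs)
  have hBm : ∀ s, MeasurableSet s → ∀ n, MeasurableSet (B s n) := fun s hs n =>
    MeasurableSet.pi (Finset.range (n + 1)).countable_toSet fun i _ => ht s hs n i
  have hmemB : ∀ s n ω, ω ∈ B s n ↔ (∀ i < n, ω i ∉ A) ∧ ω n ∈ A ∧ (ω n).1 ∈ s := by
    intro s n ω
    simp only [B, Set.mem_pi, Finset.coe_range, Set.mem_Iio]
    constructor
    · intro h
      refine ⟨fun i hi => ?_, ?_⟩
      · simpa [t, hi] using h i (hi.trans (Nat.lt_succ_self n))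
      · simpa [t] using h n (Nat.lt_succ_self n)
    · rintro ⟨h1, h2⟩ i hi
      rcases Nat.lt_succ_iff_lt_or_eq.1 hi with hi | rfl
      · simpa [t, hi] using h1 i hi
      · simpa [t] using h2
  have hBμ : ∀ s, MeasurableSet s → ∀ n, drawsLaw η xy (B s n) =
      drawLaw η xy Aᶜ ^ n * drawLaw η xy (A ∩ Prod.fst ⁻¹' s) := by
    intro s hs n
    rw [drawsLaw_pi_range hη xy _ (ht s hs n), Finset.prod_range_succ]
    congr 1
    · rw [Finset.prod_congr rfl (g := fun _ => drawLaw η xy Aᶜ)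
        fun i hi => by simp [t, Finset.mem_range.1 hi]]
      simp
    · simp [t]
  have hBd : ∀ s, Pairwise (Function.onFun Disjoint (B s)) := by
    intro s
    refine (pairwise_disjoint_on (B s)).2 fun m n hmn => ?_
    rw [Set.disjoint_left]
    intro ω h1 h2
    rw [hmemB] at h1 h2
    exact h2.1 m hmn h1.2.1
  have hNm : MeasurableSet {ω | ¬ Stops f f' xy ω} := by
    simp only [stops_iff]
    refine (MeasurableSet.iUnion fun n => ?_ : MeasurableSet
      (⋃ n, {ω : ℕ → Draw d | ω n ∈ A})).compl.congr (by ext; simp [hAdef])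
    exact hA.preimage (measurable_pi_apply n)
  -- The second set accounts for the default value 0 on runs that never stop. The decomposition also
  -- yields measurability of `returned`.
  have hpre : ∀ s : Set (Euc d), returned f f' xy ⁻¹' s =
      (⋃ n, B s n) ∪ {ω | ¬ Stops f f' xy ω ∧ (0 : Euc d) ∈ s} := by
    classical
    intro s
    ext ω
    simp only [Set.mem_preimage, Set.mem_union, Set.mem_iUnion, Set.mem_ofPred_eq, hmemB]
    by_cases hst : Stops f f' xy ω
    · have hex := (stops_iff ω).1 hst
      have hfirst := returned_eq_of_first_accept (fun i hi => Nat.find_min hex hi)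
        (Nat.find_spec hex)
      simp only [hst, not_true_eq_false, false_and, or_false]
      constructor
      · intro h
        exact ⟨Nat.find hex, fun i hi => Nat.find_min hex hi, Nat.find_spec hex, hfirst ▸ h⟩
      · rintro ⟨n, h1, h2, h3⟩
        rwa [returned_eq_of_first_accept h1 h2]
    · rw [returned_eq_zero_of_not_stops hst]
      have : ∀ n, ω n ∉ A := fun n hn => hst ((stops_iff ω).2 ⟨n, hn⟩)
      simp [hst, this]
  have hpm : ∀ s : Set (Euc d), MeasurableSet {ω | ¬ Stops f f' xy ω ∧ (0 : Euc d) ∈ s} := fun s =>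
    hNm.inter (MeasurableSet.const _)
  have hret : Measurable (returned f f' xy) := by
    intro s hs
    rw [hpre]
    exact (MeasurableSet.iUnion (hBm s hs)).union (hpm s)
  ext s hs
  have hnull : drawsLaw η xy {ω | ¬ Stops f f' xy ω ∧ (0 : Euc d) ∈ s} = 0 :=
    measure_mono_null (fun ω (h : ¬ Stops f f' xy ω ∧ (0 : Euc d) ∈ s) => h.1)
      (ae_iff.1 (ae_stops hη hf hacc))
  rw [outputLaw, Measure.map_apply hret hs, hpre, measure_congr (union_ae_eq_left_of_ae_eq_empty
    (ae_eq_empty.2 hnull)), measure_iUnion (hBd s) (hBm s hs)]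
  simp_rw [hBμ s hs]
  rw [ENNReal.tsum_mul_right, ENNReal.tsum_geometric, one_sub_measure_compl hη hf,
    Measure.smul_apply, Measure.map_apply measurable_fst hs,
    Measure.restrict_apply (measurable_fst hs), smul_eq_mul, Set.inter_comm]

end Loop

/-! ### Wasserstein bound from a difference of densities. -/

theorem min_add_tsub_right (a b : ℝ≥0∞) : min a b + (a - b) = a := by
  rcases le_total a b with h | h
  · rw [min_eq_left h, tsub_eq_zero_of_le h, add_zero]
  · rw [min_eq_right h, add_tsub_cancel_of_le h]

/-- Two probability densities are coupled by keeping their common part on the diagonal and taking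
the remainders independent. -/
theorem wasserstein2_withDensity_le {d : ℕ} {γ : Measure (Euc d)} [SFinite γ]
    {a b : Euc d → ℝ≥0∞} (ha : Measurable a) (hb : Measurable b)
    (ha1 : ∫⁻ x, a x ∂γ = 1) (hb1 : ∫⁻ x, b x ∂γ = 1) (m : Euc d) :
    wasserstein2 (γ.withDensity a) (γ.withDensity b) ≤
      (∫⁻ x, ENNReal.ofReal (2 * ‖x - m‖ ^ 2) * ((a x - b x) + (b x - a x)) ∂γ) ^ (1 / 2 : ℝ) := by
  have hmin : Measurable fun x => min (a x) (b x) := ha.min hb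
  have hab : Measurable fun x => a x - b x := ha.sub hb
  have hba : Measurable fun x => b x - a x := hb.sub ha
  set μ₀ := γ.withDensity fun x => min (a x) (b x)
  set μ₁ := γ.withDensity fun x => a x - b x
  set μ₂ := γ.withDensity fun x => b x - a x
  have hμa : μ₀ + μ₁ = γ.withDensity a := by
    rw [← withDensity_add_left hmin]
    congr 1 with x
    exact min_add_tsub_right _ _
  have hμb : μ₀ + μ₂ = γ.withDensity b := by
    rw [← withDensity_add_left hmin]
    congr 1 with x
    simp only [Pi.add_apply, min_comm (a x)]
    exact min_add_tsub_right _ _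
  have hu1 : μ₀ Set.univ + μ₁ Set.univ = 1 := by
    rw [← Measure.add_apply, hμa, withDensity_apply _ .univ, setLIntegral_univ, ha1]
  have hu2 : μ₀ Set.univ + μ₂ Set.univ = 1 := by
    rw [← Measure.add_apply, hμb, withDensity_apply _ .univ, setLIntegral_univ, hb1]
  have h0 : μ₀ Set.univ ≠ ⊤ := fun h => by simp [h] at hu1
  have h1 : μ₁ Set.univ ≠ ⊤ := fun h => by simp [h] at hu1
  have h12 : μ₂ Set.univ = μ₁ Set.univ :=
    (ENNReal.add_right_inj h0).1 (hu2.trans hu1.symm)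
  -- Both remainders have mass δ, so dividing their product by δ restores the marginals. If δ = 0
  -- both vanish, and the convention ∞ * 0 = 0 covers the case.
  set δ := μ₁ Set.univ with hδ
  have hsmul : ∀ μ : Measure (Euc d), μ Set.univ = δ → (δ⁻¹ * δ) • μ = μ := by
    intro μ hμ
    rcases eq_or_ne δ 0 with h | h
    · rw [h, Measure.measure_univ_eq_zero] at hμ
      simp [hμ]
    · rw [ENNReal.inv_mul_cancel h h1, one_smul]
  have hdiag : Measurable fun x : Euc d => (x, x) := by fun_prop
  set κ : Measure (Euc d × Euc d) := μ₀.map (fun x => (x, x)) + δ⁻¹ • μ₁.prod μ₂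
  have hfst : κ.map Prod.fst = γ.withDensity a := by
    rw [Measure.map_add _ _ measurable_fst, Measure.map_map measurable_fst hdiag,
      Measure.map_smul, Measure.map_fst_prod, h12, smul_smul, hsmul μ₁ rfl, ← hμa]
    congr 1
    exact Measure.map_id
  have hsnd : κ.map Prod.snd = γ.withDensity b := by
    rw [Measure.map_add _ _ measurable_snd, Measure.map_map measurable_snd hdiag,
      Measure.map_smul, Measure.map_snd_prod, smul_smul, hsmul μ₂ h12, ← hμb]
    congr 1
    exact Measure.map_id
  have hκ : IsProbabilityMeasure κ := ⟨by
    have : κ.map Prod.fst Set.univ = 1 := by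
      rw [hfst, withDensity_apply _ .univ, setLIntegral_univ, ha1]
    rwa [Measure.map_apply measurable_fst .univ, Set.preimage_univ] at this⟩
  rw [wasserstein2]
  apply ENNReal.rpow_le_rpow _ (by norm_num)
  refine (iInf₂_le (⟨κ, hκ⟩ : ProbabilityMeasure (Euc d × Euc d)) ⟨hfst, hsnd⟩).trans ?_
  have hcost : Measurable fun p : Euc d × Euc d => ENNReal.ofReal (‖p.1 - p.2‖ ^ 2) := by fun_prop
  have hh : Measurable fun x : Euc d => ENNReal.ofReal (2 * ‖x - m‖ ^ 2) := by fun_prop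
  change ∫⁻ p, ENNReal.ofReal (‖p.1 - p.2‖ ^ 2) ∂κ ≤ _
  rw [lintegral_add_measure, lintegral_map hcost hdiag, lintegral_smul_measure]
  simp only [sub_self, norm_zero, ne_eq, OfNat.ofNat_ne_zero, not_false_eq_true, zero_pow,
    ENNReal.ofReal_zero, lintegral_zero, zero_add, mul_add]
  have hrhs : ∫⁻ x, ENNReal.ofReal (2 * ‖x - m‖ ^ 2) * (a x - b x) +
        ENNReal.ofReal (2 * ‖x - m‖ ^ 2) * (b x - a x) ∂γ =
      ∫⁻ x, ENNReal.ofReal (2 * ‖x - m‖ ^ 2) ∂μ₁ + ∫⁻ x, ENNReal.ofReal (2 * ‖x - m‖ ^ 2) ∂μ₂ := by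
    rw [lintegral_add_left (f := fun x => ENNReal.ofReal (2 * ‖x - m‖ ^ 2) * (a x - b x)) (hh.mul hab), lintegral_withDensity_eq_lintegral_mul _ hab hh,
      lintegral_withDensity_eq_lintegral_mul _ hba hh]
    simp only [Pi.mul_apply, mul_comm]
  rw [hrhs]
  have hle : ∫⁻ p, ENNReal.ofReal (‖p.1 - p.2‖ ^ 2) ∂(μ₁.prod μ₂) ≤
      ∫⁻ p, (ENNReal.ofReal (2 * ‖p.1 - m‖ ^ 2) + ENNReal.ofReal (2 * ‖p.2 - m‖ ^ 2))
        ∂(μ₁.prod μ₂) := by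
    refine lintegral_mono fun p => ?_
    rw [← ENNReal.ofReal_add (by positivity) (by positivity)]
    apply ENNReal.ofReal_le_ofReal
    have h := norm_sub_le_norm_sub_add_norm_sub p.1 m p.2
    rw [norm_sub_rev m p.2] at h
    nlinarith [sq_nonneg (‖p.1 - m‖ - ‖p.2 - m‖), norm_nonneg (p.1 - p.2), norm_nonneg (p.1 - m),
      norm_nonneg (p.2 - m)]
  refine (mul_le_mul_right hle _).trans ?_
  have hm1 : Measurable fun p : Euc d × Euc d => ENNReal.ofReal (2 * ‖p.1 - m‖ ^ 2) := by fun_prop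
  have hm2 : Measurable fun p : Euc d × Euc d => ENNReal.ofReal (2 * ‖p.2 - m‖ ^ 2) := by fun_prop
  rw [lintegral_add_left hm1, lintegral_prod _ hm1.aemeasurable, lintegral_prod _ hm2.aemeasurable]
  simp only [lintegral_const, h12]
  rw [lintegral_mul_const _ hh, ← hδ, ← add_mul, mul_comm _ δ, ← mul_assoc]
  exact mul_le_of_le_one_left' (ENNReal.inv_mul_le_one _)

/-! ### Exponential moment of the log ratio under the step-size condition. -/

theorem IsSemiSmooth.norm_gradient_sub_le {d : ℕ} {f : Euc d → ℝ} {f' : Euc d → Euc d} {L α : ℝ}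
    (h : IsSemiSmooth f f' L α) (m : Euc d) {x : Euc d} (hx : DifferentiableAt ℝ f x) :
    ‖gradient f x - f' m‖ ≤ L * ‖x - m‖ ^ α := by
  rw [← h.subgradient.eq_gradient x hx]
  exact h.holder x m

/-- The weighted arithmetic-geometric mean inequality that converts the bound on the step size into
a bound on the exponent of Pisier's inequality. -/
theorem exponent_le {δ L α η T r : ℝ} (hδ : 0 < δ) (hL : 0 < L) (hα : 0 ≤ α) (hα1 : α ≤ 1)
    (hη : 0 < η) (hT : 0 < T)
    (hstep : η ≤ (49 * L ^ (2 / (α + 1)) * δ ^ (α / (α + 1)) * T)⁻¹) (hr : 0 ≤ r) :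
    Real.pi ^ 2 / 8 * (2 * T * √η * (L * (√η * r) ^ α)) ^ 2 ≤ T / 4 + r ^ 2 / (4 * δ) := by
  have hα0 : 0 < α + 1 := by linarith
  set t := r ^ 2 / δ with ht
  have ht0 : 0 ≤ t := by positivity
  -- The step-size condition raised to the power α + 1, which clears the fractional exponents.
  have hK : (49 * T) ^ (α + 1) * (L ^ 2 * δ ^ α * (η * η ^ α)) ≤ 1 := by
    have h1 : 49 * T * L ^ (2 / (α + 1)) * δ ^ (α / (α + 1)) * η ≤ 1 := by
      rw [le_inv_comm₀ hη (by positivity)] at hstep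
      calc _ = (49 * L ^ (2 / (α + 1)) * δ ^ (α / (α + 1)) * T) * η := by ring
        _ ≤ η⁻¹ * η := by gcongr
        _ = 1 := inv_mul_cancel₀ hη.ne'
    have h2 := Real.rpow_le_one (by positivity) h1 hα0.le
    rw [Real.mul_rpow (by positivity) hη.le, Real.mul_rpow (by positivity) (by positivity),
      Real.mul_rpow (by positivity) (by positivity), ← Real.rpow_mul hL.le, ← Real.rpow_mul hδ.le,
      div_mul_cancel₀ _ hα0.ne', div_mul_cancel₀ _ hα0.ne', Real.rpow_two,
      Real.rpow_add hη, Real.rpow_one] at h2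
    linarith
  have hr2 : ((√η * r) ^ α) ^ 2 = η ^ α * (δ ^ α * t ^ α) := by
    rw [← Real.rpow_natCast, ← Real.rpow_mul (by positivity), mul_comm α, Real.rpow_mul (by positivity),
      ← Real.mul_rpow hδ.le ht0, ← Real.mul_rpow hη.le (by positivity)]
    congr 1
    rw [Nat.cast_ofNat, Real.rpow_two, mul_pow, Real.sq_sqrt hη.le, ht]
    field_simp
  have hamgm : T ^ (1 - α) * t ^ α ≤ (1 - α) * T + α * t :=
    Real.geom_mean_le_arith_mean2_weighted (by linarith) hα hT.le ht0 (by ring)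
  have h49 : (49 : ℝ) ≤ 49 ^ (α + 1) := by
    calc (49 : ℝ) = 49 ^ (1 : ℝ) := by simp
      _ ≤ _ := Real.rpow_le_rpow_of_exponent_le (by norm_num) (by linarith)
  -- The constant 49 only has to absorb the factor 2π² from Pisier's inequality at order 2T.
  have hpi : 2 * Real.pi ^ 2 ≤ 49 := by nlinarith [Real.pi_lt_d2, Real.pi_pos]
  have hTT : T ^ (1 - α) * T ^ (α + 1) = T ^ 2 := by
    rw [← Real.rpow_add hT, ← Real.rpow_two]; congr 1; ring
  set X := L ^ 2 * δ ^ α * (η * η ^ α) with hX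
  have hX0 : 0 < X := by positivity
  have hXT : 2 * Real.pi ^ 2 * T ^ 2 * X ≤ T ^ (1 - α) := by
    calc 2 * Real.pi ^ 2 * T ^ 2 * X ≤ 49 ^ (α + 1) * T ^ 2 * X := by
          gcongr; linarith
      _ = T ^ (1 - α) * ((49 * T) ^ (α + 1) * X) := by
          rw [← hTT, Real.mul_rpow (by norm_num) hT.le]; ring
      _ ≤ T ^ (1 - α) * 1 := by gcongr
      _ = _ := mul_one _
  calc _ = (2 * Real.pi ^ 2 * T ^ 2 * X) * t ^ α / 4 := by
        rw [mul_pow, mul_pow, mul_pow, mul_pow, Real.sq_sqrt hη.le, hr2, hX]; ring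
    _ ≤ T ^ (1 - α) * t ^ α / 4 := by gcongr
    _ ≤ ((1 - α) * T + α * t) / 4 := by gcongr
    _ ≤ (1 * T + 1 * t) / 4 := by gcongr; linarith
    _ = _ := by rw [ht]; field_simp

section ExponentialMoment

variable {d : ℕ} {f : Euc d → ℝ} {f' : Euc d → Euc d} {L α η T : ℝ}

theorem locallyLipschitz_shifted_affine (hf : LocallyLipschitz f) (m : Euc d) (c s : ℝ) :
    LocallyLipschitz (fun ξ : Euc d => c * shifted f f' m (m + s • ξ)) := by
  have h1 : ContDiff ℝ 1 (fun ξ : Euc d => m + s • ξ) := by fun_prop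
  have h2 : ContDiff ℝ 1 (fun p : ℝ × Euc d => c * (p.1 - inner ℝ (f' m) p.2)) :=
    contDiff_const.mul (contDiff_fst.sub (contDiff_const.inner ℝ contDiff_snd))
  exact h2.locallyLipschitz.comp ((hf.comp h1.locallyLipschitz).prodMk h1.locallyLipschitz)

theorem gradient_shifted_affine (m : Euc d) (c s : ℝ) {ξ : Euc d}
    (hx : DifferentiableAt ℝ f (m + s • ξ)) :
    gradient (fun ξ : Euc d => c * shifted f f' m (m + s • ξ)) ξ =
      (c * s) • (gradient f (m + s • ξ) - f' m) := by
  apply HasGradientAt.gradient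
  rw [hasGradientAt_iff_hasFDerivAt]
  have h1 : HasFDerivAt (fun ξ : Euc d => m + s • ξ) (s • ContinuousLinearMap.id ℝ (Euc d)) ξ :=
    ((hasFDerivAt_id ξ).const_smul s).const_add m
  have h2 := hx.hasFDerivAt.comp ξ h1
  have h3 := ((innerSL ℝ (f' m)).hasFDerivAt (x := m + s • ξ)).comp ξ h1
  refine ((h2.sub h3).const_mul c).congr_fderiv ?_
  ext v
  simp
  ring

/-- Exponential moment of the log acceptance ratio. -/
theorem lintegral_exp_shifted_sub_le (hd : 1 ≤ d) (h : IsSemiSmooth f f' L α) (hL : 0 < L)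
    (hα : 0 ≤ α) (hα1 : α ≤ 1) (hη : 0 < η) (hT : 0 < T)
    (hstep : η ≤ (49 * L ^ (2 / (α + 1)) * (d : ℝ) ^ (α / (α + 1)) * T)⁻¹) (m : Euc d) :
    ∫⁻ p, ENNReal.ofReal (Real.exp (2 * T *
        (shifted f f' m (m + √η • p.2) - shifted f f' m (m + √η • p.1))))
        ∂((stdGaussian (Euc d)).prod (stdGaussian (Euc d))) ≤
      ENNReal.ofReal (Real.exp (T / 4) * √2) := by
  have hd' : (0 : ℝ) < d := by exact_mod_cast hd
  simp_rw [mul_sub]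
  refine (lintegral_exp_sub_stdGaussian_le (F := fun ξ : Euc d =>
    2 * T * shifted f f' m (m + √η • ξ))
    (locallyLipschitz_shifted_affine h.subgradient.locallyLipschitz m _ _)).trans ?_
  have hdiff : ∀ᵐ ξ ∂(stdGaussian (Euc d)), DifferentiableAt ℝ f (m + √η • ξ) := by
    apply ae_of_ae_map (f := fun ξ : Euc d => m + √η • ξ) (by fun_prop)
    rw [← proposal_eq_map_stdGaussian hη]
    exact (tilted_absolutelyContinuous _ _).ae_le
      h.subgradient.locallyLipschitz.ae_differentiableAt
  calc _ ≤ ∫⁻ x, ENNReal.ofReal (Real.exp (T / 4)) *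
        ENNReal.ofReal (Real.exp (‖x‖ ^ 2 / (4 * d))) ∂(stdGaussian (Euc d)) := by
        apply lintegral_mono_ae
        filter_upwards [hdiff] with ξ hξ
        rw [← ENNReal.ofReal_mul (by positivity), ← Real.exp_add]
        apply ENNReal.ofReal_le_ofReal
        rw [Real.exp_le_exp]
        refine le_trans ?_ (exponent_le hd' hL hα hα1 hη hT hstep (norm_nonneg ξ))
        rw [gradient_shifted_affine m _ _ hξ, norm_smul, Real.norm_of_nonneg (by positivity)]
        have := h.norm_gradient_sub_le m hξ
        rw [add_sub_cancel_left, norm_smul, Real.norm_of_nonneg (Real.sqrt_nonneg _)] at this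
        gcongr
    _ ≤ _ := by
        rw [lintegral_const_mul _ (by fun_prop), ENNReal.ofReal_mul (by positivity)]
        gcongr
        exact lintegral_exp_sq_norm_stdGaussian_le hd

end ExponentialMoment

/-! ### The truncated ratio, its excess, and the two densities. -/

/-- The acceptance ratio `ρ = exp (g z - g x)`. -/
noncomputable def ratio {d : ℕ} (g : Euc d → ℝ) (p : Euc d × Euc d) : ℝ≥0∞ :=
  ENNReal.ofReal (Real.exp (g p.2 - g p.1))

/-- The mean over `z` of the ratio truncated at `2`. -/
noncomputable def truncatedMean {d : ℕ} (g : Euc d → ℝ) (γ : Measure (Euc d)) (x : Euc d) : ℝ≥0∞ :=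
  ∫⁻ z, min (ratio g (x, z)) 2 ∂γ

/-- The mean over `z` of the excess of the ratio over `2`. -/
noncomputable def excessMean {d : ℕ} (g : Euc d → ℝ) (γ : Measure (Euc d)) (x : Euc d) : ℝ≥0∞ :=
  ∫⁻ z, (ratio g (x, z) - 2) ∂γ

section Ratio

variable {d : ℕ} {g : Euc d → ℝ} {γ : Measure (Euc d)}

theorem measurable_ratio (hg : Measurable g) : Measurable (ratio g) := by
  unfold ratio; fun_prop

theorem measurable_truncatedMean [SFinite γ] (hg : Measurable g) :
    Measurable (truncatedMean g γ) :=
  ((measurable_ratio hg).min measurable_const).lintegral_prod_right'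

theorem measurable_excessMean [SFinite γ] (hg : Measurable g) : Measurable (excessMean g γ) :=
  ((measurable_ratio hg).sub measurable_const).lintegral_prod_right'

theorem truncatedMean_le_two [IsProbabilityMeasure γ] (x : Euc d) : truncatedMean g γ x ≤ 2 := by
  calc truncatedMean g γ x ≤ ∫⁻ _, 2 ∂γ := lintegral_mono fun z => min_le_right _ _
    _ = 2 := by simp

/-- If neither term is truncated this is s + 1/s ≥ 2; otherwise one term already equals 2. -/
theorem two_le_min_exp_add_min_exp_neg (t : ℝ) :
    2 ≤ min (ENNReal.ofReal (Real.exp t)) 2 + min (ENNReal.ofReal (Real.exp (-t))) 2 := by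
  rcases le_total (ENNReal.ofReal (Real.exp t)) 2 with h1 | h1
  · rcases le_total (ENNReal.ofReal (Real.exp (-t))) 2 with h2 | h2
    · rw [min_eq_left h1, min_eq_left h2, ← ENNReal.ofReal_add (by positivity) (by positivity)]
      rw [show (2 : ℝ≥0∞) = ENNReal.ofReal 2 by simp]
      apply ENNReal.ofReal_le_ofReal
      have h3 : Real.exp t * Real.exp (-t) = 1 := by rw [← Real.exp_add]; simp
      nlinarith [sq_nonneg (Real.exp t - Real.exp (-t)), Real.exp_pos t, Real.exp_pos (-t)]
    · rw [min_eq_right h2]; exact le_add_self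
  · rw [min_eq_right h1]; exact le_self_add

theorem one_le_lintegral_truncatedMean [IsProbabilityMeasure γ] (hg : Measurable g) :
    1 ≤ ∫⁻ x, truncatedMean g γ x ∂γ := by
  have hm : Measurable fun p => min (ratio g p) 2 := (measurable_ratio hg).min measurable_const
  have h1 : ∫⁻ x, truncatedMean g γ x ∂γ = ∫⁻ p, min (ratio g p) 2 ∂(γ.prod γ) :=
    (lintegral_prod _ hm.aemeasurable).symm
  have h2 : ∫⁻ p, min (ratio g p.swap) 2 ∂(γ.prod γ) = ∫⁻ p, min (ratio g p) 2 ∂(γ.prod γ) :=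
    (Measure.measurePreserving_swap (μ := γ) (ν := γ)).lintegral_comp hm
  have h3 : 2 ≤ 2 * ∫⁻ p, min (ratio g p) 2 ∂(γ.prod γ) := by
    calc (2 : ℝ≥0∞) = ∫⁻ _, 2 ∂(γ.prod γ) := by simp
      _ ≤ ∫⁻ p, (min (ratio g p) 2 + min (ratio g p.swap) 2) ∂(γ.prod γ) := by
        refine lintegral_mono fun p => ?_
        have := two_le_min_exp_add_min_exp_neg (g p.2 - g p.1)
        rwa [neg_sub] at this
      _ = _ := by rw [lintegral_add_left hm, h2, two_mul]
  rw [h1]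
  have := (ENNReal.mul_le_mul_iff_right (a := 2) (by simp) (by simp)).1
    ((mul_one (2 : ℝ≥0∞)).le.trans h3)
  exact this

/-- Without truncation the ratio factorizes, so averaging over z leaves a multiple of exp (-g x):
the unnormalized target density. -/
theorem truncatedMean_add_excessMean [SFinite γ] (hg : Measurable g) (x : Euc d) :
    truncatedMean g γ x + excessMean g γ x =
      ENNReal.ofReal (Real.exp (-g x)) * ∫⁻ z, ENNReal.ofReal (Real.exp (g z)) ∂γ := by
  have hm : Measurable fun z => min (ratio g (x, z)) 2 :=
    ((measurable_ratio hg).min measurable_const).comp measurable_prodMk_left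
  rw [truncatedMean, excessMean, ← lintegral_add_left hm, ← lintegral_const_mul _ (by fun_prop)]
  congr 1 with z
  rw [min_add_tsub_right, ratio, ← ENNReal.ofReal_mul (by positivity), ← Real.exp_add]
  congr 2
  ring

/-- Reweighting a probability measure by `exp (-g)`, in terms of the truncated ratio. -/
theorem tilted_neg_eq_withDensity [IsProbabilityMeasure γ] (hg : Measurable g)
    (hΔ : ∫⁻ x, excessMean g γ x ∂γ ≠ ⊤) :
    γ.tilted (fun x => -g x) = γ.withDensity fun x =>
      (∫⁻ x, truncatedMean g γ x ∂γ + ∫⁻ x, excessMean g γ x ∂γ)⁻¹ *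
        (truncatedMean g γ x + excessMean g γ x) := by
  have hT : ∫⁻ x, truncatedMean g γ x ∂γ ≠ ⊤ := by
    refine ne_top_of_le_ne_top (b := 2) (by simp) ?_
    calc _ ≤ ∫⁻ _, 2 ∂γ := lintegral_mono fun x => truncatedMean_le_two x
      _ = 2 := by simp
  set M := ∫⁻ z, ENNReal.ofReal (Real.exp (g z)) ∂γ with hM
  set N := ∫⁻ z, ENNReal.ofReal (Real.exp (-g z)) ∂γ with hN
  have hB : ∫⁻ x, truncatedMean g γ x ∂γ + ∫⁻ x, excessMean g γ x ∂γ = N * M := by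
    rw [← lintegral_add_left (measurable_truncatedMean hg)]
    simp_rw [truncatedMean_add_excessMean hg]
    rw [lintegral_mul_const _ (by fun_prop)]
  have hNM : N * M ≠ ⊤ := by rw [← hB]; exact ENNReal.add_ne_top.2 ⟨hT, hΔ⟩
  have hpos : ∀ h : Euc d → ℝ, Measurable h → ∫⁻ z, ENNReal.ofReal (Real.exp (h z)) ∂γ ≠ 0 := by
    intro h hh h0
    rw [lintegral_eq_zero_iff (by fun_prop)] at h0
    obtain ⟨z, hz⟩ := h0.exists
    simp at hz
    exact absurd hz (not_le.2 (Real.exp_pos _))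
  have hM0 : M ≠ 0 := hpos g hg
  have hN0 : N ≠ 0 := hpos _ hg.neg
  -- A finite product of two nonzero factors forces both to be finite; this supplies the
  -- integrability of exp (-g).
  have hMt : M ≠ ⊤ := fun h => hNM (by rw [h, ENNReal.mul_top hN0])
  have hNt : N ≠ ⊤ := fun h => hNM (by rw [h, ENNReal.top_mul hM0])
  have hint : Integrable (fun x => Real.exp (-g x)) γ :=
    (lintegral_ofReal_ne_top_iff_integrable (by fun_prop)
      (ae_of_all _ fun _ => (Real.exp_pos _).le)).1 hNt
  have hN' : N = ENNReal.ofReal (∫ x, Real.exp (-g x) ∂γ) :=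
    (ofReal_integral_eq_lintegral_ofReal hint (ae_of_all _ fun _ => (Real.exp_pos _).le)).symm
  have hI : 0 < ∫ x, Real.exp (-g x) ∂γ := by
    by_contra h
    exact hN0 (by rw [hN', ENNReal.ofReal_eq_zero.2 (not_lt.1 h)])
  rw [hB, Measure.tilted]
  congr 1 with x
  rw [truncatedMean_add_excessMean hg, ENNReal.ofReal_div_of_pos hI, ← hN',
    ENNReal.mul_inv (Or.inl hN0) (Or.inl hNt), ← hM, mul_comm (ENNReal.ofReal _) M, mul_assoc,
    ← mul_assoc M⁻¹, ENNReal.inv_mul_cancel hM0 hMt, one_mul, mul_comm, div_eq_mul_inv]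

/-- The two truncated differences sum to the absolute difference of the densities. The first is at
most r times 1/A - 1/(A + Δ) ≤ Δ; the second is at most s. -/
theorem tsub_add_tsub_le {A Δ r s : ℝ≥0∞} (hA : 1 ≤ A) (hA' : A ≠ ⊤) (hΔ : Δ ≠ ⊤) (hr : r ≤ 2) :
    (A⁻¹ * r - (A + Δ)⁻¹ * (r + s)) + ((A + Δ)⁻¹ * (r + s) - A⁻¹ * r) ≤ 2 * Δ + s := by
  have hB1 : (A + Δ)⁻¹ ≤ 1 := ENNReal.inv_le_one.2 (hA.trans le_self_add)
  have hA1 : A⁻¹ ≤ 1 := ENNReal.inv_le_one.2 hA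
  have hA0 : A ≠ 0 := (zero_lt_one.trans_le hA).ne'
  have hinv : A⁻¹ ≤ (A + Δ)⁻¹ + Δ := by
    have hB : (A + Δ)⁻¹ * (A + Δ) = 1 :=
      ENNReal.inv_mul_cancel (fun h => hA0 (add_eq_zero.1 h).1) (ENNReal.add_ne_top.2 ⟨hA', hΔ⟩)
    calc A⁻¹ = (A + Δ)⁻¹ * (A + Δ) * A⁻¹ := by rw [hB, one_mul]
      _ = (A + Δ)⁻¹ * (A * A⁻¹) + (A + Δ)⁻¹ * Δ * A⁻¹ := by ring
      _ = (A + Δ)⁻¹ + (A + Δ)⁻¹ * Δ * A⁻¹ := by rw [ENNReal.mul_inv_cancel hA0 hA', mul_one]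
      _ ≤ (A + Δ)⁻¹ + 1 * Δ * 1 := by gcongr
      _ = _ := by rw [one_mul, mul_one]
  apply add_le_add
  · rw [tsub_le_iff_right]
    calc A⁻¹ * r ≤ ((A + Δ)⁻¹ + Δ) * r := by gcongr
      _ = (A + Δ)⁻¹ * r + r * Δ := by ring
      _ ≤ (A + Δ)⁻¹ * (r + s) + 2 * Δ := by gcongr; exact le_self_add
      _ = _ := add_comm _ _
  · rw [tsub_le_iff_right]
    calc (A + Δ)⁻¹ * (r + s) = (A + Δ)⁻¹ * r + (A + Δ)⁻¹ * s := by ring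
      _ ≤ A⁻¹ * r + 1 * s := by gcongr; exact le_self_add
      _ = _ := by rw [one_mul, add_comm]

end Ratio

/-! ### Acceptance probability, output density and target density. -/

section Acceptance

variable {d : ℕ} {f : Euc d → ℝ} {f' : Euc d → Euc d} {xy : Euc d} {η : ℝ}

/-- The source of the truncation at 2: an acceptance probability cannot exceed 1. -/
theorem volume_restrict_Icc_setOf_le (c : ℝ) :
    (volume : Measure ℝ).restrict (Set.Icc 0 1) {u | u ≤ 1 / 2 * c} =
      2⁻¹ * min (ENNReal.ofReal c) 2 := by
  have hset : {u : ℝ | u ≤ 1 / 2 * c} ∩ Set.Icc 0 1 = Set.Icc 0 (min (1 / 2 * c) 1) := by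
    ext u
    simp only [Set.mem_inter_iff, Set.mem_ofPred_eq, Set.mem_Icc, le_min_iff]
    tauto
  have h2 : (2 : ℝ≥0∞)⁻¹ = ENNReal.ofReal (1 / 2) := by
    rw [one_div, ENNReal.ofReal_inv_of_pos two_pos]; simp
  rw [Measure.restrict_apply (measurableSet_le (f := fun u : ℝ => u) measurable_id
    measurable_const), hset,
    Real.volume_Icc, sub_zero, show (2 : ℝ≥0∞) = ENNReal.ofReal 2 by simp, ← ENNReal.ofReal_min,
    ← show (2 : ℝ≥0∞) = ENNReal.ofReal 2 by simp, h2, ← ENNReal.ofReal_mul (by norm_num)]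
  congr 1
  rw [mul_min_of_nonneg _ _ (by norm_num)]
  norm_num

theorem map_fst_restrict_acceptSet (hη : 0 < η) (hf : Continuous f) :
    ((drawLaw η xy).restrict (acceptSet f f' xy)).map Prod.fst =
      (2 : ℝ≥0∞)⁻¹ • (proposal η xy).withDensity
        (truncatedMean (shifted f f' xy) (proposal η xy)) := by
  have := isProbabilityMeasure_proposal hη xy
  have hA := measurableSet_acceptSet (f' := f') (xy := xy) hf
  ext s hs
  have hsA : MeasurableSet (Prod.fst ⁻¹' s ∩ acceptSet f f' xy) := (measurable_fst hs).inter hA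
  rw [Measure.map_apply measurable_fst hs, Measure.restrict_apply (measurable_fst hs),
    Measure.smul_apply, withDensity_apply _ hs, smul_eq_mul,
    ← lintegral_const_mul' _ _ (by simp), ← lintegral_indicator hs, drawLaw,
    Measure.prod_apply hsA]
  congr 1 with x
  by_cases hx : x ∈ s
  · rw [Set.indicator_of_mem hx, Measure.prod_apply (measurable_prodMk_left hsA), truncatedMean,
      ← lintegral_const_mul' _ _ (by simp)]
    congr 1 with z
    rw [ratio, ← volume_restrict_Icc_setOf_le]
    congr 1 with u
    simp [acceptSet, hx]
  · rw [Set.indicator_of_notMem hx]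
    have : Prod.mk x ⁻¹' (Prod.fst ⁻¹' s ∩ acceptSet f f' xy) = ∅ := by
      ext w
      simp [hx]
    rw [this, measure_empty]

theorem drawLaw_acceptSet (hη : 0 < η) (hf : Continuous f) :
    drawLaw η xy (acceptSet f f' xy) =
      2⁻¹ * ∫⁻ x, truncatedMean (shifted f f' xy) (proposal η xy) x ∂(proposal η xy) := by
  have h := congrArg (fun μ => μ Set.univ) (map_fst_restrict_acceptSet (f' := f') (xy := xy) hη hf)
  simpa [Measure.map_apply measurable_fst MeasurableSet.univ] using h

theorem drawLaw_acceptSet_ge (hη : 0 < η) (hf : Continuous f) :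
    2⁻¹ ≤ drawLaw η xy (acceptSet f f' xy) := by
  have := isProbabilityMeasure_proposal hη xy
  rw [drawLaw_acceptSet hη hf]
  exact le_mul_of_one_le_right' (one_le_lintegral_truncatedMean (measurable_shifted hf))

theorem outputLaw_eq_withDensity (hη : 0 < η) (hf : Continuous f) :
    outputLaw f f' η xy = (proposal η xy).withDensity fun x =>
      (∫⁻ x, truncatedMean (shifted f f' xy) (proposal η xy) x ∂(proposal η xy))⁻¹ *
        truncatedMean (shifted f f' xy) (proposal η xy) x := by
  have := isProbabilityMeasure_proposal hη xy
  have hacc : drawLaw η xy (acceptSet f f' xy) ≠ 0 := fun h => by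
    simpa [h] using drawLaw_acceptSet_ge (f' := f') (xy := xy) hη hf
  rw [outputLaw_eq hη hf hacc, map_fst_restrict_acceptSet hη hf, drawLaw_acceptSet hη hf,
    smul_smul, ENNReal.mul_inv (Or.inl (by simp)) (Or.inl (by simp)), inv_inv, mul_comm, ← mul_assoc,
    ENNReal.inv_mul_cancel (by simp) (by simp), one_mul,
    ← withDensity_smul _ (measurable_truncatedMean (measurable_shifted hf))]
  rfl

theorem tilted_add_const {Ω : Type*} [MeasurableSpace Ω] (μ : Measure Ω) (F : Ω → ℝ) (c : ℝ) :
    μ.tilted (fun x => F x + c) = μ.tilted F := by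
  simp only [Measure.tilted, Real.exp_add, integral_mul_const]
  congr 1 with x
  rw [mul_div_mul_right _ _ (Real.exp_pos c).ne']

/-- By stationarity of `xy`, the target is the proposal reweighted by `exp (-g)`. -/
theorem rgoTarget_eq_tilted (hη : 0 < η) {y : Euc d} (hxy : f' xy + (1 / η) • (xy - y) = 0) :
    rgoTarget f η y = (proposal η xy).tilted (fun x => -shifted f f' xy x) := by
  have hb : 0 < 1 / (2 * η) := by positivity
  rw [proposal, tilted_tilted (integrable_exp_neg_sq_norm_sub hb xy), rgoTarget,
    ← tilted_add_const _ (fun x => -f x - 1 / (2 * η) * ‖x - y‖ ^ 2)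
      ((1 / (2 * η)) * ‖xy - y‖ ^ 2 - inner ℝ ((1 / η) • (xy - y)) xy)]
  congr 1
  ext x
  have hf' : f' xy = -((1 / η) • (xy - y)) := eq_neg_of_add_eq_zero_left hxy
  have hn : ‖x - y‖ ^ 2 = ‖x - xy‖ ^ 2 + 2 * inner ℝ (x - xy) (xy - y) + ‖xy - y‖ ^ 2 := by
    rw [← norm_add_sq_real]; congr 2; abel
  simp only [Pi.add_apply, shifted, hf', hn, inner_neg_left, real_inner_smul_left]
  rw [inner_sub_left, real_inner_comm x, real_inner_comm xy]
  field_simp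
  ring

end Acceptance

/-! ### Bounds on the weighted excess. -/

/-- Young's inequality with parameter ε separates the weight from the excess. With y = exp (D - log
2), the excess 2y - 2 is at most y²/2, so its square is controlled by y⁴, hence by y^(2T) because y
≥ 1 and T ≥ 2. -/
theorem weighted_excess_le {w v ε T D δ t : ℝ} (hε : 0 < ε) (hT : 2 ≤ T)
    (hw : w = 24 * δ + 8 * δ * t) (ht : 0 ≤ t) (hv0 : 0 ≤ v) (hv : v = 0 ∨ v = Real.exp D - 2) :
    w * v ≤ ε * (288 * δ ^ 2 * Real.exp t) +
      Real.exp (2 * T * (D - Real.log 2)) / (8 * ε) := by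
  have hw2 : w ^ 2 ≤ 576 * δ ^ 2 * Real.exp t := by
    have h1 : (t + 3) ^ 2 ≤ 9 * Real.exp t := by
      nlinarith [Real.quadratic_le_exp_of_nonneg ht]
    calc w ^ 2 = 64 * δ ^ 2 * (t + 3) ^ 2 := by rw [hw]; ring
      _ ≤ 64 * δ ^ 2 * (9 * Real.exp t) := by gcongr
      _ = _ := by ring
  have hv2 : v ^ 2 ≤ 1 / 4 * Real.exp (2 * T * (D - Real.log 2)) := by
    rcases hv with rfl | hv
    · rw [zero_pow two_ne_zero]; positivity
    set y := Real.exp (D - Real.log 2) with hy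
    have hyD : Real.exp D = 2 * y := by
      rw [hy, Real.exp_sub, Real.exp_log two_pos]; ring
    have hs : 0 ≤ D - Real.log 2 := by
      rw [← Real.one_le_exp_iff, ← hy]; linarith
    have hvy : v ≤ 1 / 2 * y ^ 2 := by nlinarith [sq_nonneg (y - 2)]
    calc v ^ 2 ≤ (1 / 2 * y ^ 2) ^ 2 := by gcongr
      _ = 1 / 4 * Real.exp (4 * (D - Real.log 2)) := by
        rw [show 4 * (D - Real.log 2) = ((4 : ℕ) : ℝ) * (D - Real.log 2) by norm_num,
          Real.exp_nat_mul, hy]; ring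
      _ ≤ _ := by gcongr; linarith
  have hyoung : w * v ≤ ε / 2 * w ^ 2 + v ^ 2 / (2 * ε) := by
    have : ε / 2 * w ^ 2 + v ^ 2 / (2 * ε) - w * v = (ε * w - v) ^ 2 / (2 * ε) := by
      field_simp; ring
    have : 0 ≤ (ε * w - v) ^ 2 / (2 * ε) := by positivity
    linarith
  calc w * v ≤ ε / 2 * w ^ 2 + v ^ 2 / (2 * ε) := hyoung
    _ ≤ ε / 2 * (576 * δ ^ 2 * Real.exp t) +
        (1 / 4 * Real.exp (2 * T * (D - Real.log 2))) / (2 * ε) := by gcongr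
    _ = _ := by field_simp; ring

section Moments

variable {d : ℕ} {f : Euc d → ℝ} {f' : Euc d → Euc d} {L α η T ζ : ℝ}

theorem lintegral_weighted_excess_le (hd : 1 ≤ d) (h : IsSemiSmooth f f' L α) (hL : 0 < L)
    (hα : 0 ≤ α) (hα1 : α ≤ 1) (hη : 0 < η) (hη1 : η ≤ 1) (hT : 2 ≤ T) (hζ : 0 < ζ)
    (hTζ : 768 * (d : ℝ) ^ 2 * Real.exp (-T) ≤ ζ ^ 4)
    (hstep : η ≤ (49 * L ^ (2 / (α + 1)) * (d : ℝ) ^ (α / (α + 1)) * T)⁻¹) (m : Euc d) :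
    ∫⁻ p, ENNReal.ofReal (24 * d + 2 * ‖√η • p.1‖ ^ 2) *
        (ratio (fun ξ => shifted f f' m (m + √η • ξ)) p - 2)
        ∂((stdGaussian (Euc d)).prod (stdGaussian (Euc d))) ≤
      ENNReal.ofReal (ζ ^ 2) := by
  have hd' : (0 : ℝ) < d := by exact_mod_cast hd
  have hg := measurable_shifted (f' := f') (xy := m) h.subgradient.locallyLipschitz.continuous
  -- Chosen so that the weight term has coefficient 288 d² ε = ζ²/3.
  set ε : ℝ := ζ ^ 2 / (864 * d ^ 2) with hε
  have hε0 : 0 < ε := by positivity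
  set c : ℝ := Real.exp (-(2 * T * Real.log 2)) / (8 * ε) with hc
  have hc0 : 0 < c := by positivity
  have hpt : ∀ p : Euc d × Euc d, ENNReal.ofReal (24 * d + 2 * ‖√η • p.1‖ ^ 2) *
      (ratio (fun ξ => shifted f f' m (m + √η • ξ)) p - 2) ≤
      ENNReal.ofReal (ζ ^ 2 / 3) * ENNReal.ofReal (Real.exp (‖p.1‖ ^ 2 / (4 * d))) +
      ENNReal.ofReal c * ENNReal.ofReal (Real.exp (2 * T *
        (shifted f f' m (m + √η • p.2) - shifted f f' m (m + √η • p.1)))) := by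
    intro p
    set D := shifted f f' m (m + √η • p.2) - shifted f f' m (m + √η • p.1) with hD
    have hn : ‖√η • p.1‖ ^ 2 ≤ ‖p.1‖ ^ 2 := by
      rw [norm_smul, mul_pow, Real.norm_of_nonneg (Real.sqrt_nonneg _), Real.sq_sqrt hη.le]
      exact mul_le_of_le_one_left (sq_nonneg _) hη1
    have hsub : ratio (fun ξ => shifted f f' m (m + √η • ξ)) p - 2 =
        ENNReal.ofReal (max (Real.exp D - 2) 0) := by
      rw [ratio, ← hD, show (2 : ℝ≥0∞) = ENNReal.ofReal 2 by simp,
        ← ENNReal.ofReal_sub _ (by norm_num), ENNReal.ofReal_max]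
      simp
    rw [hsub, ← ENNReal.ofReal_mul (by positivity), ← ENNReal.ofReal_mul (by positivity),
      ← ENNReal.ofReal_mul (by positivity), ← ENNReal.ofReal_add (by positivity) (by positivity)]
    apply ENNReal.ofReal_le_ofReal
    have key := weighted_excess_le (w := 24 * d + 2 * ‖p.1‖ ^ 2) (v := max (Real.exp D - 2) 0)
      (ε := ε) (T := T) (D := D) (δ := d) (t := ‖p.1‖ ^ 2 / (4 * d)) hε0 hT
      (by field_simp; ring) (by positivity) (le_max_right _ _) ((max_choice _ _).symm)
    calc _ ≤ (24 * d + 2 * ‖p.1‖ ^ 2) * max (Real.exp D - 2) 0 := by gcongr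
      _ ≤ _ := key
      _ = _ := by
        congr 1
        · rw [hε]; field_simp; norm_num
        · rw [hc, div_mul_eq_mul_div, ← Real.exp_add]; congr 2; ring
  refine (lintegral_mono hpt).trans ?_
  have hm1 : Measurable fun p : Euc d × Euc d =>
      ENNReal.ofReal (Real.exp (‖p.1‖ ^ 2 / (4 * d))) := by fun_prop
  have hm2 : Measurable fun p : Euc d × Euc d => ENNReal.ofReal (Real.exp (2 * T *
        (shifted f f' m (m + √η • p.2) - shifted f f' m (m + √η • p.1)))) := by fun_prop
  rw [lintegral_add_left (hm1.const_mul _), lintegral_const_mul _ hm1, lintegral_const_mul _ hm2,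
    lintegral_prod _ hm1.aemeasurable]
  simp only [lintegral_const, measure_univ, mul_one]
  -- Exactly what is needed for 2T log 2 - T/4 ≥ T: the gain at the threshold beats the growth of
  -- the moment.
  have hlog : (5 / 8 : ℝ) ≤ Real.log 2 := by linarith [Real.log_two_gt_d9]
  have hsqrt : √2 ≤ 3 / 2 := by
    rw [Real.sqrt_le_left (by norm_num)]; norm_num
  have hfin : ζ ^ 2 / 3 * √2 + c * (Real.exp (T / 4) * √2) ≤ ζ ^ 2 := by
    have h1 : Real.exp (-(2 * T * Real.log 2)) * Real.exp (T / 4) ≤ Real.exp (-T) := by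
      rw [← Real.exp_add, Real.exp_le_exp]; nlinarith
    have h2 : c * (Real.exp (T / 4) * √2) ≤ ζ ^ 2 * (108 / 768 * (3 / 2)) := by
      calc c * (Real.exp (T / 4) * √2) =
          (Real.exp (-(2 * T * Real.log 2)) * Real.exp (T / 4)) / (8 * ε) * √2 := by
            rw [hc]; ring
        _ ≤ Real.exp (-T) / (8 * ε) * (3 / 2) := by gcongr
        _ = 108 / 768 * (768 * (d : ℝ) ^ 2 * Real.exp (-T)) / ζ ^ 2 * (3 / 2) := by
            rw [hε]; field_simp; norm_num
        _ ≤ 108 / 768 * ζ ^ 4 / ζ ^ 2 * (3 / 2) := by gcongr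
        _ = _ := by field_simp
    nlinarith [sq_nonneg ζ]
  calc _ ≤ ENNReal.ofReal (ζ ^ 2 / 3) * ENNReal.ofReal (√2) +
        ENNReal.ofReal c * ENNReal.ofReal (Real.exp (T / 4) * √2) := by
        gcongr
        · exact lintegral_exp_sq_norm_stdGaussian_le hd
        · exact lintegral_exp_shifted_sub_le hd h hL hα hα1 hη (by linarith) hstep m
    _ = ENNReal.ofReal (ζ ^ 2 / 3 * √2 + c * (Real.exp (T / 4) * √2)) := by
        rw [← ENNReal.ofReal_mul (by positivity), ← ENNReal.ofReal_mul hc0.le,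
          ← ENNReal.ofReal_add (by positivity) (by positivity)]
    _ ≤ _ := ENNReal.ofReal_le_ofReal hfin

theorem lintegral_two_mul_sq_norm_stdGaussian_le (hd : 1 ≤ d) :
    ∫⁻ ξ, ENNReal.ofReal (2 * ‖ξ‖ ^ 2) ∂(stdGaussian (Euc d)) ≤ ENNReal.ofReal (12 * d) := by
  have hd' : (0 : ℝ) < d := by exact_mod_cast hd
  have hsqrt : √2 ≤ 3 / 2 := by
    rw [Real.sqrt_le_left (by norm_num)]; norm_num
  calc _ ≤ ∫⁻ ξ, ENNReal.ofReal (8 * d) * ENNReal.ofReal (Real.exp (‖ξ‖ ^ 2 / (4 * d)))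
        ∂(stdGaussian (Euc d)) := by
        refine lintegral_mono fun ξ => ?_
        rw [← ENNReal.ofReal_mul (by positivity)]
        apply ENNReal.ofReal_le_ofReal
        calc 2 * ‖ξ‖ ^ 2 = 8 * d * (‖ξ‖ ^ 2 / (4 * d)) := by field_simp; ring
          _ ≤ _ := by gcongr; linarith [Real.add_one_le_exp (‖ξ‖ ^ 2 / (4 * d))]
    _ ≤ ENNReal.ofReal (8 * d) * ENNReal.ofReal (√2) := by
        rw [lintegral_const_mul _ (by fun_prop)]
        gcongr
        exact lintegral_exp_sq_norm_stdGaussian_le hd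
    _ ≤ _ := by
        rw [← ENNReal.ofReal_mul (by positivity)]
        apply ENNReal.ofReal_le_ofReal
        nlinarith

theorem lintegral_proposal (hη : 0 < η) (m : Euc d) {F : Euc d → ℝ≥0∞} (hF : Measurable F) :
    ∫⁻ x, F x ∂(proposal η m) = ∫⁻ ξ, F (m + √η • ξ) ∂(stdGaussian (Euc d)) := by
  rw [proposal_eq_map_stdGaussian hη, lintegral_map hF (by fun_prop)]

theorem excessMean_proposal (hη : 0 < η) (m : Euc d) {g : Euc d → ℝ} (hg : Measurable g)
    (ξ : Euc d) :
    excessMean g (proposal η m) (m + √η • ξ) =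
      excessMean (fun ξ => g (m + √η • ξ)) (stdGaussian (Euc d)) ξ := by
  have hm : Measurable fun z => ratio g (m + √η • ξ, z) - 2 :=
    ((measurable_ratio hg).comp measurable_prodMk_left).sub measurable_const
  rw [excessMean, lintegral_proposal hη m hm]
  rfl

theorem lintegral_excessMean_le (hd : 1 ≤ d) (h : IsSemiSmooth f f' L α) (hL : 0 < L)
    (hα : 0 ≤ α) (hα1 : α ≤ 1) (hη : 0 < η) (hη1 : η ≤ 1) (hT : 2 ≤ T) (hζ : 0 < ζ)
    (hTζ : 768 * (d : ℝ) ^ 2 * Real.exp (-T) ≤ ζ ^ 4)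
    (hstep : η ≤ (49 * L ^ (2 / (α + 1)) * (d : ℝ) ^ (α / (α + 1)) * T)⁻¹) (m : Euc d) :
    ∫⁻ x, excessMean (shifted f f' m) (proposal η m) x ∂(proposal η m) ≠ ⊤ ∧
    ∫⁻ x, ENNReal.ofReal (2 * ‖x - m‖ ^ 2) *
      (2 * (∫⁻ x, excessMean (shifted f f' m) (proposal η m) x ∂(proposal η m)) +
        excessMean (shifted f f' m) (proposal η m) x) ∂(proposal η m) ≤
      ENNReal.ofReal (ζ ^ 2) := by
  have := isProbabilityMeasure_proposal hη m
  have hd' : (0 : ℝ) < d := by exact_mod_cast hd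
  have hg : Measurable (shifted f f' m) :=
    measurable_shifted h.subgradient.locallyLipschitz.continuous
  set G : Euc d → ℝ := fun ξ => shifted f f' m (m + √η • ξ) with hGdef
  have hG : Measurable G := by fun_prop
  set S := stdGaussian (Euc d) with hS
  have hexm : Measurable (excessMean G S) := measurable_excessMean hG
  set Δ := ∫⁻ x, excessMean (shifted f f' m) (proposal η m) x ∂(proposal η m) with hΔ
  have hΔG : Δ = ∫⁻ ξ, excessMean G S ξ ∂S := by
    rw [hΔ, lintegral_proposal hη m (measurable_excessMean hg)]
    simp_rw [excessMean_proposal hη m hg]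
    rfl
  have hmain := lintegral_weighted_excess_le hd h hL hα hα1 hη hη1 hT hζ hTζ hstep m
  have hmr : Measurable fun p => ratio G p - 2 := (measurable_ratio hG).sub measurable_const
  have hmw : Measurable fun p : Euc d × Euc d =>
      ENNReal.ofReal (24 * d + 2 * ‖√η • p.1‖ ^ 2) := by fun_prop
  rw [lintegral_prod (fun p : Euc d × Euc d => ENNReal.ofReal (24 * d + 2 * ‖√η • p.1‖ ^ 2) *
    (ratio G p - 2)) (hmw.mul hmr).aemeasurable] at hmain
  have hinner : ∀ ξ : Euc d, ∫⁻ z, ENNReal.ofReal (24 * d + 2 * ‖√η • ξ‖ ^ 2) *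
      (ratio G (ξ, z) - 2) ∂S = ENNReal.ofReal (24 * d) * excessMean G S ξ +
        ENNReal.ofReal (2 * ‖√η • ξ‖ ^ 2) * excessMean G S ξ := by
    intro ξ
    rw [lintegral_const_mul' _ _ ENNReal.ofReal_ne_top,
      ENNReal.ofReal_add (by positivity) (by positivity), add_mul, excessMean]
  change ∫⁻ ξ, ∫⁻ z, ENNReal.ofReal (24 * d + 2 * ‖√η • ξ‖ ^ 2) * (ratio G (ξ, z) - 2) ∂S ∂S ≤ _
    at hmain
  simp_rw [hinner] at hmain
  rw [lintegral_add_left (hexm.const_mul _), lintegral_const_mul _ hexm, ← hΔG] at hmain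
  constructor
  -- The weight is at least 24d > 0, so the weighted bound already forces Δ to be finite.
  · intro htop
    rw [htop, ENNReal.mul_top (by simp; omega), top_add] at hmain
    exact absurd hmain (by simp)
  · refine le_trans ?_ hmain
    have hmF : Measurable fun x : Euc d => ENNReal.ofReal (2 * ‖x - m‖ ^ 2) *
        (2 * Δ + excessMean (shifted f f' m) (proposal η m) x) :=
      Measurable.mul (by fun_prop) ((measurable_excessMean hg).const_add _)
    have hpush : ∫⁻ x, ENNReal.ofReal (2 * ‖x - m‖ ^ 2) *
        (2 * Δ + excessMean (shifted f f' m) (proposal η m) x) ∂(proposal η m) =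
        ∫⁻ ξ, (ENNReal.ofReal (2 * ‖√η • ξ‖ ^ 2) * (2 * Δ) +
          ENNReal.ofReal (2 * ‖√η • ξ‖ ^ 2) * excessMean G S ξ) ∂S := by
      rw [lintegral_proposal hη m hmF]
      simp_rw [excessMean_proposal hη m hg, add_sub_cancel_left, mul_add]
      rfl
    have hm1 : Measurable fun ξ : Euc d => ENNReal.ofReal (2 * ‖√η • ξ‖ ^ 2) := by fun_prop
    rw [hpush, lintegral_add_left (hm1.mul_const _), lintegral_mul_const _ hm1, ← mul_assoc]
    gcongr
    -- The constant part 2Δ of the density difference costs 2 · 12d · Δ, the origin of 24d in the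
    -- weight.
    calc _ ≤ (∫⁻ ξ, ENNReal.ofReal (2 * ‖ξ‖ ^ 2) ∂S) * 2 := by
          gcongr with ξ
          rw [norm_smul, Real.norm_of_nonneg (Real.sqrt_nonneg _)]
          exact mul_le_of_le_one_left (norm_nonneg _) (Real.sqrt_le_one.2 hη1)
      _ ≤ ENNReal.ofReal (12 * d) * 2 := by
          gcongr; exact lintegral_two_mul_sq_norm_stdGaussian_le hd
      _ = ENNReal.ofReal (24 * d) := by
          rw [show (2 : ℝ≥0∞) = ENNReal.ofReal 2 by simp, ← ENNReal.ofReal_mul (by positivity)]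
          congr 1; ring

end Moments

/-! ### The main theorem. -/

theorem theorem4 :
    ∃ C : NNReal, ∀ (d : ℕ) (_ : 1 ≤ d) (L α : ℝ) (_ : 0 < L) (_ : 0 ≤ α) (_ : α ≤ 1)
      (f : Euc d → ℝ) (f' : Euc d → Euc d) (_ : IsSemiSmooth f f' L α)
      (ζ η : ℝ) (_ : 0 < ζ) (_ : 0 < η)
      (_ : η ≤ min
        ((49 * L ^ (2 / (α + 1)) * (d : ℝ) ^ (α / (α + 1)) *
          (2 + Real.log (1 + 192 * ((d : ℝ) ^ 2 + 2 * (d : ℝ)) / ζ ^ 4)))⁻¹) 1)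
      (y xy : Euc d) (_ : f' xy + (1 / η) • (xy - y) = 0),
      ((∀ᵐ ω ∂(drawsLaw η xy), Stops f f' xy ω) ∧
        wasserstein2 (outputLaw f f' η xy) (rgoTarget f η y) ≤ ENNReal.ofReal ζ) ∧
      (ζ < 2 * Real.sqrt (2 * (d : ℝ)) →
        ∫⁻ ω, totalQueries f f' xy ω ∂(drawsLaw η xy) ≤ (C : ℝ≥0∞)) := by
  refine ⟨4, fun d hd L α hL hα hα1 f f' h ζ η hζ hη hstep y xy hxy => ?_⟩
  have hf : Continuous f := h.subgradient.locallyLipschitz.continuous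
  have hprob := isProbabilityMeasure_proposal hη xy
  have hg : Measurable (shifted f f' xy) := measurable_shifted hf
  have hacc := drawLaw_acceptSet_ge (f' := f') (xy := xy) hη hf
  have hacc0 : drawLaw η xy (acceptSet f f' xy) ≠ 0 := fun h0 => by simp [h0] at hacc
  refine ⟨⟨ae_stops hη hf hacc0, ?_⟩, fun _ => ?_⟩
  · have hd' : (0 : ℝ) < d := by exact_mod_cast hd
    set q : ℝ := 192 * ((d : ℝ) ^ 2 + 2 * (d : ℝ)) / ζ ^ 4 with hq
    have hq0 : 0 < q := by positivity
    have hlog : 0 ≤ Real.log (1 + q) := Real.log_nonneg (by linarith)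
    set T : ℝ := 2 + Real.log (1 + q) with hTdef
    have hT : 2 ≤ T := by linarith
    -- Since exp 2 ≥ 4, exp T ≥ 4q, and 4qζ⁴ = 768(d² + 2d).
    have hTζ : 768 * (d : ℝ) ^ 2 * Real.exp (-T) ≤ ζ ^ 4 := by
      have he2 : (4 : ℝ) ≤ Real.exp 2 := by
        have := Real.quadratic_le_exp_of_nonneg (x := 2) (by norm_num)
        linarith
      have heT : 4 * q ≤ Real.exp T := by
        rw [hTdef, Real.exp_add, Real.exp_log (by linarith)]
        nlinarith
      have hqd : 768 * (d : ℝ) ^ 2 ≤ 4 * q * ζ ^ 4 := by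
        rw [hq]; field_simp; nlinarith
      rw [Real.exp_neg, ← div_eq_mul_inv, div_le_iff₀ (Real.exp_pos _)]
      calc _ ≤ 4 * q * ζ ^ 4 := hqd
        _ ≤ Real.exp T * ζ ^ 4 := by gcongr
        _ = _ := mul_comm _ _
    obtain ⟨hΔ, hW⟩ := lintegral_excessMean_le hd h hL hα hα1 hη (hstep.trans (min_le_right _ _))
      hT hζ hTζ (hstep.trans (min_le_left _ _)) xy
    have hR := measurable_truncatedMean (γ := proposal η xy) hg
    have hE := measurable_excessMean (γ := proposal η xy) hg
    set A := ∫⁻ x, truncatedMean (shifted f f' xy) (proposal η xy) x ∂(proposal η xy) with hA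
    set Δ := ∫⁻ x, excessMean (shifted f f' xy) (proposal η xy) x ∂(proposal η xy) with hΔdef
    have hA1 : 1 ≤ A := one_le_lintegral_truncatedMean hg
    have hA0 : A ≠ 0 := (zero_lt_one.trans_le hA1).ne'
    have hAt : A ≠ ⊤ := by
      refine ne_top_of_le_ne_top (b := 2) (by simp) ?_
      calc A ≤ ∫⁻ _, 2 ∂(proposal η xy) := lintegral_mono truncatedMean_le_two
        _ = 2 := by simp
    rw [outputLaw_eq_withDensity hη hf, rgoTarget_eq_tilted hη hxy,
      tilted_neg_eq_withDensity hg hΔ]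
    refine (wasserstein2_withDensity_le (hR.const_mul _) ((hR.add hE).const_mul _) ?_ ?_ xy).trans ?_
    · rw [lintegral_const_mul _ hR]
      exact ENNReal.inv_mul_cancel hA0 hAt
    · rw [lintegral_const_mul _ (hR.add hE)]
      simp only [Pi.add_apply]
      rw [lintegral_add_left hR]
      exact ENNReal.inv_mul_cancel (fun h0 => hA0 (add_eq_zero.1 h0).1)
        (ENNReal.add_ne_top.2 ⟨hAt, hΔ⟩)
    · have hle : ∀ x, ENNReal.ofReal (2 * ‖x - xy‖ ^ 2) *
          ((A⁻¹ * truncatedMean (shifted f f' xy) (proposal η xy) x -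
            (A + Δ)⁻¹ * (truncatedMean (shifted f f' xy) (proposal η xy) x +
              excessMean (shifted f f' xy) (proposal η xy) x)) +
          ((A + Δ)⁻¹ * (truncatedMean (shifted f f' xy) (proposal η xy) x +
              excessMean (shifted f f' xy) (proposal η xy) x) -
            A⁻¹ * truncatedMean (shifted f f' xy) (proposal η xy) x)) ≤
          ENNReal.ofReal (2 * ‖x - xy‖ ^ 2) *
            (2 * Δ + excessMean (shifted f f' xy) (proposal η xy) x) := fun x =>
        mul_le_mul_right (tsub_add_tsub_le hA1 hAt hΔ (truncatedMean_le_two x)) _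
      calc _ ≤ (ENNReal.ofReal (ζ ^ 2)) ^ (1 / 2 : ℝ) :=
            ENNReal.rpow_le_rpow ((lintegral_mono hle).trans hW) (by norm_num)
        _ = ENNReal.ofReal ζ := by
            rw [ENNReal.ofReal_rpow_of_nonneg (by positivity) (by norm_num), ← Real.sqrt_eq_rpow,
              Real.sqrt_sq hζ.le]
  -- Two evaluations per pass and acceptance probability at least 1/2 give the constant 4.
  · rw [lintegral_totalQueries hη hf]
    calc 2 * (drawLaw η xy (acceptSet f f' xy))⁻¹ ≤ 2 * (2⁻¹)⁻¹ := by
          gcongr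
      _ = ((4 : NNReal) : ℝ≥0∞) := by
          rw [inv_inv]; norm_num
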